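/- Let $\mathcal M=(M,<,\ldots)$ be a first-order structure expanding a (nonempty) dense linear order without endpoints. Equip $M$ with the order topology and each $M^n$ with the product topology. ``Definable'' means definable in $\mathcal M$ with parameters; a map $f:X\to M^n$ with $X\subseteq M^m$ is definable if $X$ and the graph of $f$ are definable. A coordinate projection $M^n\to M^d$ is a map $(x_1,\ldots,x_n)\mapsto(x_{i_1},\ldots,x_{i_d})$ with $i_1<\cdots<i_d$. Assume: * $\mathcal M$ is definably complete: every definable subset of $M$ has a supremum and an infimum in $M\cup\{\pm\infty\}$; * $\mathcal M$ is locally o-minimal: for every definable $X\subseteq M$ and every $a\in M$ there is an open interval $I\ni a$ such that $X\cap I$ is a finite union of points and open intervals; * property (a): the image of a nonempty definable discrete subset of $M^n$ under a coordinate projection is again discrete. For nonempty definable $X\subseteq M^n$ let $\dim X$ be the largest integer $d\ge 0$ such that $\pi(X)$ has nonempty interior for some coordinate projection $\pi:M^n\to M^d$; put $\dim\emptyset=-\infty$. Then: 1. If $X\subseteq Y$ are definable subsets of $M^n$, then $\dim X\le\dim Y$. 2. Let $\sigma$ be a permutation of $\{1,\ldots,n\}$ and $\overline\sigma(x_1,\ldots,x_n)=(x_{\sigma(1)},\ldots,x_{\sigma(n)})$.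 Then $\dim X=\dim\overline\sigma(X)$ for every definable $X\subseteq M^n$. 3. If $X\subseteq M^m$ and $Y\subseteq M^n$ are definable, then $\dim(X\times Y)=\dim X+\dim Y$. 4. If $X,Y\subseteq M^n$ are definable, then $\dim(X\cup Y)=\max\{\dim X,\dim Y\}$. 5. If $X\subseteq M^m$ and $f:X\to M^n$ is a definable map, then $\dim f(X)\le\dim X$. 6. If $X\subseteq M^m$ is nonempty, $f:X\to M^n$ is a definable map and $\mathcal D(f)\subseteq X$ is the set of points at which $f$ is discontinuous (for the subspace topology on $X$), then $\dim\mathcal D(f)<\dim X$. 7. If $X\subseteq M^n$ is a nonempty definable set and $\partial X=\overline X\setminus X$, then $\dim\partial X<\dim X$. -/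

import Mathlib

universe u v w

namespace TameDim

/-- Definable subsets of `M^n`; as usual in tame topology, "definable" means
definable in the given structure with parameters from `M`. -/
def IsDef (L : FirstOrder.Language.{u, v}) {M : Type w} [L.Structure M] {n : ℕ}
    (X : Set (Fin n → M)) : Prop :=
  (Set.univ : Set M).Definable L X

/-- Every definable subset of `M` has a supremum and an infimum in `M ∪ {-∞, +∞}`
(which is `WithBot (WithTop M)`). -/
def DefinablyComplete (L : FirstOrder.Language.{u, v}) (M : Type w) [L.Structure M]
    [LinearOrder M] : Prop :=
  ∀ X : Set M, (Set.univ : Set M).Definable₁ L X →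
    (∃ s : WithBot (WithTop M),
      IsLUB ((fun x : M => ((x : WithTop M) : WithBot (WithTop M))) '' X) s) ∧
    (∃ s : WithBot (WithTop M),
      IsGLB ((fun x : M => ((x : WithTop M) : WithBot (WithTop M))) '' X) s)

/-- Local o-minimality: near every point of `M`, every definable subset of `M` is a finite union
of points and open intervals. (A degenerate pair `q.2 ≤ q.1` gives the empty set.) -/
def LocallyOMinimal (L : FirstOrder.Language.{u, v}) (M : Type w) [L.Structure M]
    [LinearOrder M] : Prop :=
  ∀ X : Set M, (Set.univ : Set M).Definable₁ L X → ∀ a : M,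
    ∃ b c : M, a ∈ Set.Ioo b c ∧ ∃ (P : Finset M) (J : Finset (M × M)),
      X ∩ Set.Ioo b c = (P : Set M) ∪ ⋃ q ∈ J, Set.Ioo q.1 q.2

/-- The coordinate projection `M^n → M^d` onto the coordinates
`ι 0 < ι 1 < ⋯ < ι (d - 1)`. -/
def coordProj {M : Type w} {n d : ℕ} (ι : Fin d ↪o Fin n) (x : Fin n → M) : Fin d → M :=
  fun i => x (ι i)

/-- Property (a): the image of a nonempty definable discrete set under a coordinate projection
is discrete (that is, its subspace topology is discrete). -/
def PropertyA (L : FirstOrder.Language.{u, v}) (M : Type w) [L.Structure M]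
    [TopologicalSpace M] : Prop :=
  ∀ (n d : ℕ) (ι : Fin d ↪o Fin n) (X : Set (Fin n → M)),
    IsDef L X → X.Nonempty → IsDiscrete X → IsDiscrete (coordProj ι '' X)

open Classical in
/-- The dimension of `X ⊆ M^n`: the largest `d` such that the image of `X` under some coordinate
projection `M^n → M^d` has nonempty interior. A coordinate projection to `M^d` requires `d ≤ n`.
For nonempty `X` the value `d = 0` always qualifies; for empty `X` no `d` qualifies and the value
is `⊥`, which plays the role of `-∞`. -/
noncomputable def dim {M : Type w} [TopologicalSpace M] {n : ℕ}
    (X : Set (Fin n → M)) : WithBot ℕ :=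
  ((Finset.range (n + 1)).filter
    (fun d => ∃ ι : Fin d ↪o Fin n, (interior (coordProj ι '' X)).Nonempty)).max

/-- The product `X × Y ⊆ M^(m+n)` of `X ⊆ M^m` and `Y ⊆ M^n`. -/
def prodSet {M : Type w} {m n : ℕ} (X : Set (Fin m → M)) (Y : Set (Fin n → M)) :
    Set (Fin (m + n) → M) :=
  {z | ∃ x ∈ X, ∃ y ∈ Y, z = Fin.append x y}

/-- The graph in `M^(m+n)` of a map `f : X → M^n` with `X ⊆ M^m`. -/
def graphSet {M : Type w} {m n : ℕ} {X : Set (Fin m → M)} (f : X → (Fin n → M)) :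
    Set (Fin (m + n) → M) :=
  {z | ∃ x : X, z = Fin.append (x : Fin m → M) (f x)}

/-- A map `f : X → M^n` is definable if its domain and its graph are definable. -/
def IsDefMap (L : FirstOrder.Language.{u, v}) {M : Type w} [L.Structure M] {m n : ℕ}
    {X : Set (Fin m → M)} (f : X → (Fin n → M)) : Prop :=
  IsDef L X ∧ IsDef L (graphSet f)

/-- The set of points of `X` at which `f : X → M^n` is discontinuous, for the subspace topology
on `X`, as a subset of `M^m`. -/
def discontSet {M : Type w} [TopologicalSpace M] {m n : ℕ} {X : Set (Fin m → M)}
    (f : X → (Fin n → M)) : Set (Fin m → M) :=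
  Subtype.val '' {x : X | ¬ ContinuousAt f x}

end TameDim

namespace TameDim

open Set Filter Topology FirstOrder FirstOrder.Language

set_option linter.unusedSectionVars false

/-! ### Spaces of tuples and definable predicates on them -/

/-! The guiding notion is that of a definable set with interior (`Fat`), and everything rests on a
Fubini principle: if, for all points of some open set, the fiber of a definable set has interior,
then the whole set has interior (`fat_prod`). Closure of sets without interior under finite unions,
and generic continuity of definable maps, come with it.

On the line, local o-minimality makes every definable predicate eventually true or eventually false
on each side of a point, so a definable set without interior is closed and discrete. Definable
completeness turns local information into information on an interval (`exists_Ioo_of_transitive`).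
Property (a), applied to graphs, shows that a definable map sends no discrete set onto a set with
interior (`not_fat_image_of_discrete`). Together these give generic continuity in one variable, and
then the exchange of the quantifiers "for all points of some interval" (`fat_swap_self`). Induction
on the number of coordinates extends union and exchange to all powers (`fatCalculus`).

For images, `exists_fat_exchange` is a Steinitz exchange: a function whose values fill an interval
on generic fibers can be replaced by a coordinate. For frontiers and discontinuities, let `d = dim
X` and project to `M^d`. Generic fibers of `X` are closed and discrete, since otherwise a further
coordinate would raise the dimension. By Fubini, a single box isolates a point in all fibers over an
open set (`exists_uniform_box`). A frontier point in that box contradicts membership in the closure;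
for discontinuities, `X` is locally the graph of a definable section, along which the map is
generically continuous. -/

/-- A space of tuples of elements of `M`: a space identified with a finite power of `M`. -/
class Tuples (M : Type w) [TopologicalSpace M] (Γ : Type w) [TopologicalSpace Γ] where
  κ : Type
  finite : Finite κ
  homeo : Γ ≃ₜ (κ → M)

attribute [instance] Tuples.finite

section Tuples

variable (M : Type w) [TopologicalSpace M]

instance Tuples.self : Tuples M M :=
  ⟨Fin 1, inferInstance, (Homeomorph.funUnique (Fin 1) M).symm⟩

instance Tuples.pi (κ : Type) [Finite κ] : Tuples M (κ → M) :=
  ⟨κ, inferInstance, Homeomorph.refl _⟩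

instance Tuples.prod (Γ Δ : Type w) [TopologicalSpace Γ] [TopologicalSpace Δ]
    [Tuples M Γ] [Tuples M Δ] : Tuples M (Γ × Δ) :=
  ⟨Tuples.κ M Γ ⊕ Tuples.κ M Δ, inferInstance,
    ((Tuples.homeo (M := M) (Γ := Γ)).prodCongr Tuples.homeo).trans
      Homeomorph.sumArrowHomeomorphProdArrow.symm⟩

/-- The coordinates of a tuple. -/
def coord {Γ : Type w} [TopologicalSpace Γ] [Tuples M Γ] (g : Γ) (j : Tuples.κ M Γ) : M :=
  Tuples.homeo g j

variable {Γ Δ : Type w} [TopologicalSpace Γ] [TopologicalSpace Δ] [Tuples M Γ] [Tuples M Δ]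

theorem coord_ext {g g' : Γ} (h : ∀ j, coord M g j = coord M g' j) : g = g' :=
  (Tuples.homeo (M := M)).injective (funext h)

@[simp] theorem coord_symm (v : Tuples.κ M Γ → M) (j : Tuples.κ M Γ) :
    coord M (Tuples.homeo.symm v : Γ) j = v j := by
  simp [coord]

@[simp] theorem coord_inl (p : Γ × Δ) (j : Tuples.κ M Γ) :
    coord M p (Sum.inl j : Tuples.κ M Γ ⊕ Tuples.κ M Δ) = coord M p.1 j := rfl

@[simp] theorem coord_inr (p : Γ × Δ) (j : Tuples.κ M Δ) :
    coord M p (Sum.inr j : Tuples.κ M Γ ⊕ Tuples.κ M Δ) = coord M p.2 j := rfl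

theorem continuous_coord (j : Tuples.κ M Γ) : Continuous (fun g : Γ => coord M g j) :=
  (continuous_apply j).comp (Tuples.homeo (M := M)).continuous

end Tuples

/-! ### Closure properties of definable predicates and maps -/

section Def

variable (L : FirstOrder.Language.{u, v}) (M : Type w) [TopologicalSpace M] [L.Structure M]
variable {Γ Δ Θ : Type w} [TopologicalSpace Γ] [TopologicalSpace Δ] [TopologicalSpace Θ]
  [Tuples M Γ] [Tuples M Δ] [Tuples M Θ]

/-- A predicate on tuples that is definable with parameters. -/
def DefPred (P : Γ → Prop) : Prop :=
  (univ : Set M).Definable L {v : Tuples.κ M Γ → M | P (Tuples.homeo.symm v)}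

/-- A map between spaces of tuples whose graph is definable. -/
def DefMap (f : Γ → Δ) : Prop := DefPred L M (fun p : Γ × Δ => p.2 = f p.1)

variable {L M}

/-- Coordinate selections pull definability back directly. Substitution of general definable maps is
reduced to this case by quantifying over the value. -/
theorem DefPred.reindex {P : Δ → Prop} (hP : DefPred L M P) (f : Γ → Δ)
    (σ : Tuples.κ M Δ → Tuples.κ M Γ) (h : ∀ g j, coord M (f g) j = coord M g (σ j)) :
    DefPred L M (fun g => P (f g)) := by
  unfold DefPred at *
  convert! hP.preimage_comp σ using 1
  ext v
  have : f (Tuples.homeo.symm v) = Tuples.homeo.symm (v ∘ σ) := by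
    apply coord_ext M
    intro j
    simp [h]
  simp [this]

theorem DefPred.and {P Q : Γ → Prop} (hP : DefPred L M P) (hQ : DefPred L M Q) :
    DefPred L M (fun g => P g ∧ Q g) := Set.Definable.inter hP hQ

theorem DefPred.or {P Q : Γ → Prop} (hP : DefPred L M P) (hQ : DefPred L M Q) :
    DefPred L M (fun g => P g ∨ Q g) := Set.Definable.union hP hQ

theorem DefPred.not {P : Γ → Prop} (hP : DefPred L M P) :
    DefPred L M (fun g => ¬ P g) := Set.Definable.compl hP

theorem DefPred.imp {P Q : Γ → Prop} (hP : DefPred L M P) (hQ : DefPred L M Q) :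
    DefPred L M (fun g => P g → Q g) := by
  simpa only [imp_iff_not_or] using hP.not.or hQ

theorem DefPred.ex {P : Γ → Δ → Prop} (hP : DefPred L M (fun p : Γ × Δ => P p.1 p.2)) :
    DefPred L M (fun g => ∃ d, P g d) := by
  unfold DefPred at *
  convert! hP.image_comp (Sum.inl : Tuples.κ M Γ → Tuples.κ M Γ ⊕ Tuples.κ M Δ) using 1
  ext v
  simp only [mem_ofPred_eq, mem_image]
  constructor
  · rintro ⟨d, hd⟩
    refine ⟨Tuples.homeo ((Tuples.homeo.symm v, d) : Γ × Δ), by simpa using hd, ?_⟩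
    ext j
    exact (coord_inl M _ _).trans (coord_symm M _ _)
  · rintro ⟨x, hx, rfl⟩
    exact ⟨_, hx⟩

theorem DefPred.all {P : Γ → Δ → Prop} (hP : DefPred L M (fun p : Γ × Δ => P p.1 p.2)) :
    DefPred L M (fun g => ∀ d, P g d) := by
  have := (DefPred.ex (P := fun g d => ¬ P g d) hP.not).not
  simpa only [not_exists, not_not] using this

theorem DefPred.all_finite {ι : Type*} [Finite ι] {P : ι → Γ → Prop}
    (hP : ∀ i, DefPred L M (P i)) : DefPred L M (fun g => ∀ i, P i g) := by
  unfold DefPred at *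
  convert! Set.definable_iInter_of_finite hP using 1
  ext; simp

theorem DefPred.ex_finite {ι : Type*} [Finite ι] {P : ι → Γ → Prop}
    (hP : ∀ i, DefPred L M (P i)) : DefPred L M (fun g => ∃ i, P i g) := by
  have := (DefPred.all_finite (fun i => (hP i).not)).not
  simpa only [not_forall, not_not] using this

theorem defPred_coord_eq (i j : Tuples.κ M Γ) :
    DefPred L M (fun g : Γ => coord M g i = coord M g j) :=
  ⟨(Term.var i).equal (Term.var j), by ext; simp⟩

theorem DefPred.eq_self : DefPred L M (fun p : Γ × Γ => p.1 = p.2) := by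
  have : DefPred L M (fun p : Γ × Γ => ∀ j, coord M p (Sum.inl j) = coord M p (Sum.inr j)) :=
    DefPred.all_finite (fun j => defPred_coord_eq _ _)
  convert this using 2 with p
  exact ⟨fun h j => by simp [h], fun h => coord_ext M h⟩

theorem DefPred.comp {P : Δ → Prop} (hP : DefPred L M P) {f : Γ → Δ} (hf : DefMap L M f) :
    DefPred L M (fun g => P (f g)) := by
  have h2 : DefPred L M (fun p : Γ × Δ => P p.2) :=
    hP.reindex Prod.snd Sum.inr (fun _ _ => rfl)
  simpa using DefPred.ex (P := fun g d => d = f g ∧ P d) (DefPred.and hf h2)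

theorem DefMap.of_reindex (f : Γ → Δ) (σ : Tuples.κ M Δ → Tuples.κ M Γ)
    (h : ∀ g j, coord M (f g) j = coord M g (σ j)) : DefMap L M f := by
  refine (DefPred.eq_self (L := L) (M := M) (Γ := Δ)).reindex
    (fun p : Γ × Δ => (p.2, f p.1)) (Sum.elim Sum.inr (Sum.inl ∘ σ)) ?_
  rintro p (j | j)
  · rfl
  · exact h _ _

theorem DefMap.id : DefMap L M (fun g : Γ => g) := .of_reindex _ (fun j => j) (fun _ _ => rfl)

theorem DefMap.comp {f : Δ → Θ} (hf : DefMap L M f) {h : Γ → Δ} (hh : DefMap L M h) :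
    DefMap L M (fun g => f (h g)) := by
  have h1 : DefPred L M (fun p : (Γ × Θ) × Δ => p.2 = h p.1.1) :=
    DefPred.reindex hh (fun p : (Γ × Θ) × Δ => (p.1.1, p.2))
      (Sum.elim (Sum.inl ∘ Sum.inl) Sum.inr) (by rintro p (j | j) <;> rfl)
  have h2 : DefPred L M (fun p : (Γ × Θ) × Δ => p.1.2 = f p.2) :=
    DefPred.reindex hf (fun p : (Γ × Θ) × Δ => (p.2, p.1.2))
      (Sum.elim Sum.inr (Sum.inl ∘ Sum.inr)) (by rintro p (j | j) <;> rfl)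
  simpa [DefMap] using DefPred.ex (P := fun (p : Γ × Θ) d => d = h p.1 ∧ p.2 = f d) (h1.and h2)

theorem DefMap.fst {f : Γ → Δ × Θ} (hf : DefMap L M f) : DefMap L M (fun g => (f g).1) :=
  (DefMap.of_reindex (Prod.fst : Δ × Θ → Δ) Sum.inl (fun _ _ => rfl)).comp hf

theorem DefMap.snd {f : Γ → Δ × Θ} (hf : DefMap L M f) : DefMap L M (fun g => (f g).2) :=
  (DefMap.of_reindex (Prod.snd : Δ × Θ → Θ) Sum.inr (fun _ _ => rfl)).comp hf

theorem DefMap.prodMk {f : Γ → Δ} {h : Γ → Θ} (hf : DefMap L M f) (hh : DefMap L M h) :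
    DefMap L M (fun g => (f g, h g)) := by
  have h1 : DefPred L M (fun p : Γ × Δ × Θ => p.2.1 = f p.1) :=
    DefPred.reindex hf (fun p : Γ × Δ × Θ => (p.1, p.2.1))
      (Sum.elim Sum.inl (Sum.inr ∘ Sum.inl)) (by rintro p (j | j) <;> rfl)
  have h2 : DefPred L M (fun p : Γ × Δ × Θ => p.2.2 = h p.1) :=
    DefPred.reindex hh (fun p : Γ × Δ × Θ => (p.1, p.2.2))
      (Sum.elim Sum.inl (Sum.inr ∘ Sum.inr)) (by rintro p (j | j) <;> rfl)
  simpa only [DefMap, Prod.ext_iff] using h1.and h2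

theorem DefMap.coord {f : Γ → Δ} (hf : DefMap L M f) (j : Tuples.κ M Δ) :
    DefMap L M (fun g => TameDim.coord M (f g) j) :=
  (DefMap.of_reindex (fun d : Δ => TameDim.coord M d j) (fun _ => j) (fun _ _ => rfl)).comp hf

theorem DefMap.apply {κ : Type} [Finite κ] {f : Γ → κ → M} (hf : DefMap L M f) (j : κ) :
    DefMap L M (fun g => f g j) := hf.coord j

theorem DefPred.eq {f h : Γ → Δ} (hf : DefMap L M f) (hh : DefMap L M h) :
    DefPred L M (fun g => f g = h g) :=
  (DefPred.eq_self (L := L) (M := M) (Γ := Δ)).comp (hf.prodMk hh)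

theorem DefMap.of_coord {f : Γ → Δ} (hf : ∀ j, DefMap L M (fun g => TameDim.coord M (f g) j)) :
    DefMap L M f := by
  have : DefPred L M (fun p : Γ × Δ => ∀ j, TameDim.coord M p.2 j = TameDim.coord M (f p.1) j) :=
    DefPred.all_finite (fun j => DefPred.eq (DefMap.id.snd.coord j) ((hf j).comp DefMap.id.fst))
  unfold DefMap
  convert this using 2 with p
  exact ⟨fun h j => by rw [h], fun h => coord_ext M h⟩

theorem DefMap.pi {κ : Type} [Finite κ] {f : κ → Γ → M} (hf : ∀ j, DefMap L M (f j)) :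
    DefMap L M (fun g j => f j g) := DefMap.of_coord hf

theorem DefMap.const (d : Δ) : DefMap L M (fun _ : Γ => d) := by
  refine DefMap.of_coord fun j => ?_
  have : DefPred L M (fun x : M => x = TameDim.coord M d j) :=
    Set.Definable.singleton_of_mem L (mem_univ _)
  exact this.comp DefMap.id.snd

theorem DefPred.mem {X : Set Δ} (hX : DefPred L M (· ∈ X)) {f : Γ → Δ} (hf : DefMap L M f) :
    DefPred L M (fun g => f g ∈ X) := hX.comp hf

/-- A functional definable relation is the graph of a definable map. -/
theorem exists_defMap [Nonempty Δ] {A : Γ → Prop} {R : Γ → Δ → Prop} (hA : DefPred L M A)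
    (hR : DefPred L M (fun p : Γ × Δ => R p.1 p.2)) (h : ∀ g, A g → ∃! d, R g d) :
    ∃ f : Γ → Δ, DefMap L M f ∧ ∀ g, A g → R g (f g) := by
  classical
  obtain ⟨d₀⟩ := ‹Nonempty Δ›
  -- Off `A` the map takes the constant value `d₀`; it is then total, and its graph stays definable
  -- because `d₀` is allowed as a parameter.
  refine ⟨fun g => if hg : A g then (h g hg).choose else d₀, ?_, ?_⟩
  · have hA' : DefPred L M (fun p : Γ × Δ => A p.1) := hA.comp DefMap.id.fst
    have := (hA'.and hR).or (hA'.not.and (DefPred.eq DefMap.id.snd (DefMap.const d₀)))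
    unfold DefMap
    convert this using 2 with p
    by_cases hp : A p.1
    · simp only [hp, dite_true, true_and, not_true, false_and, or_false]
      exact ⟨fun h1 => h1 ▸ (h _ hp).choose_spec.1, fun h1 => (h _ hp).choose_spec.2 _ h1⟩
    · simp [hp]
  · intro g hg
    simp only [hg, dite_true]
    exact (h g hg).choose_spec.1

theorem DefPred.image {X : Set Γ} (hX : DefPred L M (· ∈ X)) {f : Γ → Δ} (hf : DefMap L M f) :
    DefPred L M (· ∈ f '' X) :=
  DefPred.ex (P := fun d g => g ∈ X ∧ f g = d)
    ((hX.mem DefMap.id.snd).and (DefPred.eq (hf.comp DefMap.id.snd) DefMap.id.fst))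

end Def

section Order

variable {L : FirstOrder.Language.{u, v}} {M : Type w} [TopologicalSpace M] [LinearOrder M]
  [L.Structure M] [L.IsOrdered] [L.OrderedStructure M]
variable {Γ Δ Θ : Type w} [TopologicalSpace Γ] [TopologicalSpace Δ] [TopologicalSpace Θ]
  [Tuples M Γ] [Tuples M Δ] [Tuples M Θ]

theorem DefPred.lt {f h : Γ → M} (hf : DefMap L M f) (hh : DefMap L M h) :
    DefPred L M (fun g => f g < h g) := by
  have : DefPred L M (fun v : Fin 2 → M => v 0 < v 1) := by
    obtain ⟨φ, hφ⟩ : ∃ φ : L.Formula (Fin 2), ∀ v : Fin 2 → M, φ.Realize v ↔ v 0 < v 1 :=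
      ⟨(Term.var (Sum.inl 0)).lt (Term.var (Sum.inl 1)), fun v => by
        simp [Formula.Realize, Term.realize_lt]⟩
    refine Set.Definable.mono (A := ∅) ?_ (empty_subset _)
    exact Set.empty_definable_iff.2 ⟨φ, by ext v; exact (hφ v).symm⟩
  have h2 : DefMap L M (fun g (j : Fin 2) => if j = 0 then f g else h g) := by
    refine DefMap.pi (f := fun (j : Fin 2) g => if j = 0 then f g else h g) fun j => ?_
    by_cases hj : j = 0 <;> simpa [hj]
  simpa using this.comp h2

theorem DefPred.le {f h : Γ → M} (hf : DefMap L M f) (hh : DefMap L M h) :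
    DefPred L M (fun g => f g ≤ h g) := by
  simpa only [not_lt] using (DefPred.lt hh hf).not

end Order

/-! ### Sets with nonempty interior -/

/-- A set with nonempty interior. -/
def Fat {X : Type*} [TopologicalSpace X] (s : Set X) : Prop := (interior s).Nonempty

section Fat

variable {X Y : Type*} [TopologicalSpace X] [TopologicalSpace Y]

theorem fat_iff {s : Set X} : Fat s ↔ ∃ x, ∀ᶠ y in 𝓝 x, y ∈ s := by
  simp only [Fat, Set.Nonempty, mem_interior_iff_mem_nhds]; rfl

theorem Fat.mono {s t : Set X} (hs : Fat s) (h : s ⊆ t) : Fat t :=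
  Set.Nonempty.mono (interior_mono h) hs

theorem Fat.nonempty {s : Set X} (hs : Fat s) : s.Nonempty := Set.Nonempty.mono interior_subset hs

theorem Fat.fibers {P : X → Y → Prop} (h : Fat {p : X × Y | P p.1 p.2}) :
    Fat {x | Fat {y | P x y}} := by
  obtain ⟨⟨x, y⟩, h⟩ := fat_iff.1 h
  refine fat_iff.2 ⟨x, ?_⟩
  filter_upwards [h.curry_nhds] with x' hx'
  exact fat_iff.2 ⟨y, hx'⟩

theorem Fat.preimage_homeomorph {s : Set Y} (hs : Fat s) (e : X ≃ₜ Y) : Fat (e ⁻¹' s) := by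
  obtain ⟨y, hy⟩ := hs
  refine ⟨e.symm y, ?_⟩
  rw [← e.preimage_interior]
  simpa using hy

theorem Fat.image_homeomorph {s : Set X} (hs : Fat s) (e : X ≃ₜ Y) : Fat (e '' s) := by
  rw [e.image_eq_preimage_symm]
  exact hs.preimage_homeomorph e.symm

theorem Fat.image_isOpenMap {s : Set X} (hs : Fat s) {f : X → Y} (hf : IsOpenMap f) :
    Fat (f '' s) :=
  (hs.image f).mono (hf.image_interior_subset s)

end Fat

/-! ### Boxes and definability of the topology -/

section Box

variable (M : Type w) [TopologicalSpace M] [LinearOrder M]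
variable {Γ : Type w} [TopologicalSpace Γ] [Tuples M Γ]

/-- Strict inequality of tuples in every coordinate. -/
def Below (a b : Γ) : Prop := ∀ j, coord M a j < coord M b j

variable [OrderTopology M]

theorem eventually_below_right [NoMaxOrder M] [NoMinOrder M] (x : Γ) :
    ∀ a, Below M a x → ∀ᶠ y in 𝓝 x, Below M a y := by
  intro a ha
  refine eventually_all.2 fun j => ?_
  exact (continuous_coord M j).continuousAt.eventually (lt_mem_nhds (ha j))

theorem eventually_below_left (x : Γ) :
    ∀ a, Below M x a → ∀ᶠ y in 𝓝 x, Below M y a := by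
  intro a ha
  refine eventually_all.2 fun j => ?_
  exact (continuous_coord M j).continuousAt.eventually (gt_mem_nhds (ha j))

/-- This makes the topology first-order: quantifying over neighbourhoods becomes quantifying over
the two corners of a box, which are themselves tuples. Hence "eventually near" and `Fat` preserve
definability. -/
theorem eventually_nhds_iff_box [NoMaxOrder M] [NoMinOrder M] {x : Γ} {P : Γ → Prop} :
    (∀ᶠ y in 𝓝 x, P y) ↔
      ∃ b c, (Below M b x ∧ Below M x c) ∧ ∀ y, Below M b y ∧ Below M y c → P y := by
  constructor
  · intro h
    rw [(Tuples.homeo (M := M) (Γ := Γ)).nhds_eq_comap, nhds_pi] at h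
    obtain ⟨⟨I, f⟩, ⟨-, hf⟩, hs⟩ := (((Filter.hasBasis_pi
      (fun i => nhds_basis_Ioo (Tuples.homeo (M := M) x i))).comap Tuples.homeo).eventually_iff).1 h
    classical
    -- A basic open set of the product leaves the coordinates outside `I` free; a box needs
    -- endpoints there too, and any will do.
    have hlo : ∀ i, ∃ l, l < coord M x i ∧ (i ∈ I → (f i).1 ≤ l) := fun i => by
      by_cases hi : i ∈ I
      · exact ⟨(f i).1, (hf i hi).1, fun _ => le_rfl⟩
      · obtain ⟨l, hl⟩ := exists_lt (coord M x i)
        exact ⟨l, hl, fun h => absurd h hi⟩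
    have hhi : ∀ i, ∃ l, coord M x i < l ∧ (i ∈ I → l ≤ (f i).2) := fun i => by
      by_cases hi : i ∈ I
      · exact ⟨(f i).2, (hf i hi).2, fun _ => le_rfl⟩
      · obtain ⟨l, hl⟩ := exists_gt (coord M x i)
        exact ⟨l, hl, fun h => absurd h hi⟩
    choose l hl hl' using hlo
    choose r hr hr' using hhi
    refine ⟨Tuples.homeo.symm l, Tuples.homeo.symm r, ⟨fun j => by simpa using hl j,
      fun j => by simpa using hr j⟩, fun y hy => ?_⟩
    apply hs
    intro i hi
    have h1 := hy.1 i
    have h2 := hy.2 i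
    simp only [coord_symm] at h1 h2
    exact ⟨(hl' i hi).trans_lt h1, h2.trans_le (hr' i hi)⟩
  · rintro ⟨b, c, ⟨h1, h2⟩, h⟩
    filter_upwards [eventually_below_right M x b h1, eventually_below_left M x c h2] with y hy hy'
    exact h y ⟨hy, hy'⟩

end Box

section

variable {L : FirstOrder.Language.{u, v}} {M : Type w} [TopologicalSpace M] [LinearOrder M]
  [L.Structure M] [L.IsOrdered] [L.OrderedStructure M]
variable {Γ Δ Θ : Type w} [TopologicalSpace Γ] [TopologicalSpace Δ] [TopologicalSpace Θ]
  [Tuples M Γ] [Tuples M Δ] [Tuples M Θ]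

theorem DefPred.below {f h : Γ → Δ} (hf : DefMap L M f) (hh : DefMap L M h) :
    DefPred L M (fun g => Below M (f g) (h g)) :=
  DefPred.all_finite fun j => DefPred.lt (hf.coord j) (hh.coord j)

variable [OrderTopology M] [NoMaxOrder M] [NoMinOrder M]

theorem DefPred.eventually_nhds {P : Γ → Δ → Prop} {f : Γ → Δ}
    (hP : DefPred L M (fun p : Γ × Δ => P p.1 p.2)) (hf : DefMap L M f) :
    DefPred L M (fun g => ∀ᶠ d in 𝓝 (f g), P g d) := by
  simp only [eventually_nhds_iff_box M]
  refine DefPred.ex (DefPred.ex (DefPred.and (DefPred.and ?_ ?_) (DefPred.all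
    (DefPred.imp (DefPred.and ?_ ?_) ?_))))
  · exact DefPred.below DefMap.id.fst.snd (hf.comp DefMap.id.fst.fst)
  · exact DefPred.below (hf.comp DefMap.id.fst.fst) DefMap.id.snd
  · exact DefPred.below DefMap.id.fst.fst.snd DefMap.id.snd
  · exact DefPred.below DefMap.id.snd DefMap.id.fst.snd
  · exact hP.comp (DefMap.id.fst.fst.fst.prodMk DefMap.id.snd)

theorem DefPred.fat {P : Γ → Δ → Prop} (hP : DefPred L M (fun p : Γ × Δ => P p.1 p.2)) :
    DefPred L M (fun g => Fat {d | P g d}) := by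
  simp only [fat_iff, mem_ofPred_eq]
  exact DefPred.ex (DefPred.eventually_nhds (P := fun (p : Γ × Δ) d => P p.1 d)
    (hP.comp (DefMap.id.fst.fst.prodMk DefMap.id.snd)) DefMap.id.snd)

end

/-! ### Definable subsets of the line -/

/-- Definably complete locally o-minimal structures in which coordinate projections of definable
discrete sets are discrete. -/
class Tame (L : FirstOrder.Language.{u, v}) (M : Type w) [L.Structure M] [LinearOrder M]
    [TopologicalSpace M] : Prop where
  complete : DefinablyComplete L M
  local_oMinimal : LocallyOMinimal L M
  discrete_proj : PropertyA L M

section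

variable {M : Type w} [LinearOrder M] [DenselyOrdered M] [NoMinOrder M] [NoMaxOrder M]
    [TopologicalSpace M] [OrderTopology M]

theorem fat_Ioo {a b : M} (h : a < b) : Fat (Ioo a b) := by
  rw [Fat, isOpen_Ioo.interior_eq]
  exact nonempty_Ioo.2 h

theorem fat_iff_Ioo {s : Set M} : Fat s ↔ ∃ a b, a < b ∧ Ioo a b ⊆ s := by
  constructor
  · intro h
    obtain ⟨x, hx⟩ := fat_iff.1 h
    obtain ⟨a, b, hab, h⟩ := mem_nhds_iff_exists_Ioo_subset.1 hx
    exact ⟨a, b, hab.1.trans hab.2, h⟩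
  · rintro ⟨a, b, hab, h⟩
    exact (fat_Ioo hab).mono h

theorem fat_of_eventually_right {s : Set M} {a : M} (h : ∀ᶠ x in 𝓝[>] a, x ∈ s) : Fat s := by
  obtain ⟨b, hb, h⟩ := mem_nhdsGT_iff_exists_Ioo_subset.1 h
  exact fat_iff_Ioo.2 ⟨a, b, hb, h⟩

theorem fat_of_eventually_left {s : Set M} {a : M} (h : ∀ᶠ x in 𝓝[<] a, x ∈ s) : Fat s := by
  obtain ⟨b, hb, h⟩ := mem_nhdsLT_iff_exists_Ioo_subset.1 h
  exact fat_iff_Ioo.2 ⟨b, a, hb, h⟩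

theorem not_fat_of_eventually_ne {s : Set M} (h : ∀ a, ∀ᶠ x in 𝓝[≠] a, x ∉ s) : ¬ Fat s := by
  intro hs
  obtain ⟨x, hx⟩ := fat_iff.1 hs
  obtain ⟨y, h1, h2⟩ :=
    (((h x).filter_mono (nhdsWithin_mono x (s := Ioi x) fun y hy => ne_of_gt hy)).and
    (hx.filter_mono nhdsWithin_le_nhds)).exists
  exact h1 h2

/-- A filter that leaves every point and decides every interval decides every finite union of these.
The filters in view are the two one-sided neighbourhood filters. -/
theorem eventually_or_of_finite_union {l : Filter M} (hl : ∀ p, ∀ᶠ x in l, x ≠ p)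
    (hI : ∀ p q, (∀ᶠ x in l, x ∈ Ioo p q) ∨ ∀ᶠ x in l, x ∉ Ioo p q)
    (P : Finset M) (J : Finset (M × M)) :
    (∀ᶠ x in l, x ∈ (P : Set M) ∪ ⋃ q ∈ J, Ioo q.1 q.2) ∨
      ∀ᶠ x in l, x ∉ (P : Set M) ∪ ⋃ q ∈ J, Ioo q.1 q.2 := by
  have h1 : ∀ᶠ x in l, ∀ p ∈ P, x ≠ p := (eventually_all_finset P).2 fun p _ => hl p
  by_cases h : ∃ q ∈ J, ∀ᶠ x in l, x ∈ Ioo q.1 q.2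
  · obtain ⟨q, hq, h⟩ := h
    left
    filter_upwards [h] with x hx
    exact Or.inr (mem_biUnion (s := (J : Set (M × M))) (t := fun q : M × M => Ioo q.1 q.2) hq hx)
  · right
    simp only [not_exists, not_and] at h
    have h2 : ∀ᶠ x in l, ∀ q ∈ J, x ∉ Ioo q.1 q.2 :=
      (eventually_all_finset J).2 fun q hq => (hI q.1 q.2).resolve_left (h q hq)
    filter_upwards [h1, h2] with x hx hx'
    simp only [mem_union, mem_iUnion, not_or, not_exists]
    exact ⟨fun hp => hx x hp rfl, hx'⟩

end

/-! ### One-sided germs, extrema, and passage from local to uniform -/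

section

variable {L : FirstOrder.Language.{u, v}} [L.IsOrdered] {M : Type w}
    [LinearOrder M] [DenselyOrdered M] [NoMinOrder M] [NoMaxOrder M] [Nonempty M]
    [TopologicalSpace M] [OrderTopology M] [L.Structure M] [L.OrderedStructure M] [Tame L M]
variable {Γ Δ Θ : Type w} [TopologicalSpace Γ] [TopologicalSpace Δ] [TopologicalSpace Θ]
  [Tuples M Γ] [Tuples M Δ] [Tuples M Θ]

theorem DefPred.germ {P : M → Prop} (hP : DefPred L M P) (a : M) {l : Filter M} (hla : l ≤ 𝓝 a)
    (hl : ∀ p, ∀ᶠ x in l, x ≠ p)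
    (hI : ∀ p q, (∀ᶠ x in l, x ∈ Ioo p q) ∨ ∀ᶠ x in l, x ∉ Ioo p q) :
    (∀ᶠ x in l, P x) ∨ ∀ᶠ x in l, ¬ P x := by
  obtain ⟨b, c, ha, S, J, h⟩ := Tame.local_oMinimal (L := L) {x | P x} hP a
  have hbc : ∀ᶠ x in l, x ∈ Ioo b c := hla (Ioo_mem_nhds ha.1 ha.2)
  have key := eventually_or_of_finite_union hl hI S J
  rw [← h] at key
  refine key.imp (fun k => ?_) (fun k => ?_)
  · filter_upwards [k] with x hx using hx.1
  · filter_upwards [k, hbc] with x hx hx' h using hx ⟨h, hx'⟩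

theorem DefPred.germ_right {P : M → Prop} (hP : DefPred L M P) (a : M) :
    (∀ᶠ x in 𝓝[>] a, P x) ∨ ∀ᶠ x in 𝓝[>] a, ¬ P x := by
  refine hP.germ a nhdsWithin_le_nhds (fun p => ?_) (fun p q => ?_)
  · rcases lt_or_ge a p with h | h
    · filter_upwards [Ioo_mem_nhdsGT h] with x hx using hx.2.ne
    · filter_upwards [self_mem_nhdsWithin] with x hx using (h.trans_lt hx).ne'
  · rcases lt_or_ge a p with h | h
    · right
      filter_upwards [Ioo_mem_nhdsGT h] with x hx h' using lt_asymm hx.2 h'.1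
    rcases lt_or_ge a q with h' | h'
    · left
      filter_upwards [Ioo_mem_nhdsGT h'] with x hx using ⟨h.trans_lt hx.1, hx.2⟩
    · right
      filter_upwards [self_mem_nhdsWithin] with x hx hx' using (h'.trans_lt hx).not_gt hx'.2

theorem DefPred.germ_left {P : M → Prop} (hP : DefPred L M P) (a : M) :
    (∀ᶠ x in 𝓝[<] a, P x) ∨ ∀ᶠ x in 𝓝[<] a, ¬ P x := by
  refine hP.germ a nhdsWithin_le_nhds (fun p => ?_) (fun p q => ?_)
  · rcases lt_or_ge p a with h | h
    · filter_upwards [Ioo_mem_nhdsLT h] with x hx using hx.1.ne'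
    · filter_upwards [self_mem_nhdsWithin] with x hx using (lt_of_lt_of_le hx h).ne
  · rcases lt_or_ge q a with h | h
    · right
      filter_upwards [Ioo_mem_nhdsLT h] with x hx h' using lt_asymm hx.1 h'.2
    rcases lt_or_ge p a with h' | h'
    · left
      filter_upwards [Ioo_mem_nhdsLT h'] with x hx using ⟨hx.1, lt_of_lt_of_le hx.2 h⟩
    · right
      filter_upwards [self_mem_nhdsWithin] with x hx hx'
      exact (lt_of_lt_of_le hx h').not_gt hx'.1

/-- A definable subset of the line without interior is closed and discrete. -/
theorem DefPred.eventually_ne {P : M → Prop} (hP : DefPred L M P) (h : ¬ Fat {x | P x}) (a : M) :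
    ∀ᶠ x in 𝓝[≠] a, ¬ P x := by
  rw [← nhdsLT_sup_nhdsGT, eventually_sup]
  exact ⟨(hP.germ_left a).resolve_left fun h' => h (fat_of_eventually_left h'),
    (hP.germ_right a).resolve_left fun h' => h (fat_of_eventually_right h')⟩

/-- Two definable sets without interior both miss a punctured neighbourhood of each point, hence so
does their union. -/
theorem fat_or {P Q : M → Prop} (hP : DefPred L M P) (hQ : DefPred L M Q)
    (h : Fat {x | P x ∨ Q x}) : Fat {x | P x} ∨ Fat {x | Q x} := by
  by_contra! hc
  refine not_fat_of_eventually_ne (fun a => ?_) h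
  filter_upwards [hP.eventually_ne hc.1 a, hQ.eventually_ne hc.2 a] with x h1 h2 h3
  exact h3.elim h1 h2

/-- Definable completeness gives an infimum in the extended line; a member and a lower bound exclude
the two infinite values. -/
theorem DefPred.exists_isGLB {P : M → Prop} (hP : DefPred L M P) {x b : M} (hx : P x)
    (hb : ∀ y, P y → b ≤ y) : ∃ s, IsGLB {y | P y} s := by
  obtain ⟨s, hs⟩ := (Tame.complete (L := L) {y | P y} hP).2
  have h1 : s ≤ ((x : WithTop M) : WithBot (WithTop M)) := hs.1 ⟨x, hx, rfl⟩
  have h2 : ((b : WithTop M) : WithBot (WithTop M)) ≤ s := by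
    apply hs.2
    rintro _ ⟨y, hy, rfl⟩
    exact WithBot.coe_le_coe.2 (WithTop.coe_le_coe.2 (hb y hy))
  induction s with
  | bot => simp at h2
  | coe s =>
    induction s with
    | top => simp at h1
    | coe s =>
      refine ⟨s, fun y hy => ?_, fun c hc => ?_⟩
      · exact WithTop.coe_le_coe.1 (WithBot.coe_le_coe.1 (hs.1 ⟨y, hy, rfl⟩))
      · refine WithTop.coe_le_coe.1 (WithBot.coe_le_coe.1 (hs.2 ?_))
        rintro _ ⟨y, hy, rfl⟩
        exact WithBot.coe_le_coe.2 (WithTop.coe_le_coe.2 (hc hy))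

theorem DefPred.exists_isLUB {P : M → Prop} (hP : DefPred L M P) {x b : M} (hx : P x)
    (hb : ∀ y, P y → y ≤ b) : ∃ s, IsLUB {y | P y} s := by
  have hQ : DefPred L M (fun y => ∀ z, P z → z ≤ y) :=
    DefPred.all ((hP.comp DefMap.id.snd).imp (DefPred.le DefMap.id.snd DefMap.id.fst))
  obtain ⟨s, hs⟩ := hQ.exists_isGLB (x := b) (b := x) hb fun y hy => hy x hx
  exact ⟨s, fun y hy => hs.2 fun z hz => hz y hy, fun c hc => hs.1 fun z hz => hc hz⟩

/-- Without interior, the set is absent immediately to the right of its infimum, so the infimum must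
belong to it. -/
theorem DefPred.exists_isLeast {P : M → Prop} (hP : DefPred L M P) (hF : ¬ Fat {x | P x}) {x b : M}
    (hx : P x) (hb : ∀ y, P y → b ≤ y) : ∃ s, IsLeast {y | P y} s := by
  obtain ⟨s, hs⟩ := hP.exists_isGLB hx hb
  refine ⟨s, ?_, hs.1⟩
  by_contra hPs
  obtain ⟨e, he, h⟩ := mem_nhdsGT_iff_exists_Ioo_subset.1
    ((hP.germ_right s).resolve_left fun h' => hF (fat_of_eventually_right h'))
  obtain ⟨y, hy, hye⟩ := hs.exists_between he
  rcases hye.1.eq_or_lt with rfl | h1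
  · exact hPs hy
  · exact h ⟨h1, hye.2⟩ hy

/-- This is induction along the line. If no interval works, then for a fixed right end `c` the set
of points related to everything up to `c` has a least element, and transitivity pushes that element
further left. -/
theorem exists_Ioo_of_transitive {R : M → M → Prop}
    (hR : DefPred L M (fun p : M × M => R p.1 p.2)) (htr : ∀ x y z, R x y → R y z → R x z)
    {I : Set M} (hI : Fat I) (h : ∀ x ∈ I, ∀ᶠ t in 𝓝[>] x, R x t) :
    ∃ a b, a < b ∧ Ioo a b ⊆ I ∧ ∀ x ∈ Ioo a b, ∀ t ∈ Ioo a b, x < t → R x t := by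
  obtain ⟨p, q, hpq, hsub⟩ := fat_iff_Ioo.1 hI
  by_contra! hc
  obtain ⟨x, hx⟩ := exists_between hpq
  -- These are the `y` that no `z` in `(x, y)` reaches, in the sense that `R z` holds on all of `(z,
  -- y]`. Since `R z` holds just to the right of `z`, they contain no interval, so they are absent
  -- just to the right of `x`.
  have hD : DefPred L M (fun y : M => (x < y ∧ y < q) ∧
      ∀ z, (x < z ∧ z < y) → ∃ t, (z < t ∧ t ≤ y) ∧ ¬ R z t) := by
    refine DefPred.and (DefPred.and (DefPred.lt (DefMap.const _) DefMap.id)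
      (DefPred.lt DefMap.id (DefMap.const _))) (DefPred.all (DefPred.imp
      (DefPred.and (DefPred.lt (DefMap.const _) DefMap.id.snd)
        (DefPred.lt DefMap.id.snd DefMap.id.fst)) (DefPred.ex (DefPred.and (DefPred.and
        (DefPred.lt DefMap.id.fst.snd DefMap.id.snd)
        (DefPred.le DefMap.id.snd DefMap.id.fst.fst)) ?_))))
    exact (hR.comp (DefMap.id.fst.snd.prodMk DefMap.id.snd)).not
  have hDF : ¬ Fat {y : M | (x < y ∧ y < q) ∧
      ∀ z, (x < z ∧ z < y) → ∃ t, (z < t ∧ t ≤ y) ∧ ¬ R z t} := by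
    intro hF
    obtain ⟨a, b, hab, hs⟩ := fat_iff_Ioo.1 hF
    obtain ⟨z, hz⟩ := exists_between hab
    have hz' := (hs hz).1
    obtain ⟨e, he, hRz⟩ := mem_nhdsGT_iff_exists_Ioo_subset.1
      (h z (hsub ⟨hx.1.trans hz'.1, hz'.2⟩))
    obtain ⟨y, hy⟩ := exists_between (lt_min he hz.2)
    obtain ⟨t, ht, hnt⟩ := (hs ⟨hz.1.trans hy.1, hy.2.trans_le (min_le_right _ _)⟩).2 z
      ⟨hz'.1, hy.1⟩
    exact hnt (hRz ⟨ht.1, ht.2.trans_lt (hy.2.trans_le (min_le_left _ _))⟩)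
  obtain ⟨e, he, hDe⟩ := mem_nhdsGT_iff_exists_Ioo_subset.1
    ((hD.germ_right x).resolve_left fun h' => hDF (fat_of_eventually_right h'))
  obtain ⟨c, hc'⟩ := exists_between (lt_min he hx.2)
  have hce := hc'.2.trans_le (min_le_left _ _)
  have hcq := hc'.2.trans_le (min_le_right _ _)
  -- The points of `(x, c]` related to everything after them up to `c`. The point `c` qualifies
  -- vacuously, and an interval of such points would be the interval excluded by `hc`.
  have hE : DefPred L M (fun y : M => (x < y ∧ y ≤ c) ∧ ∀ t, (y < t ∧ t ≤ c) → R y t) := by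
    refine DefPred.and (DefPred.and (DefPred.lt (DefMap.const _) DefMap.id)
      (DefPred.le DefMap.id (DefMap.const _))) (DefPred.all (DefPred.imp
      (DefPred.and (DefPred.lt DefMap.id.fst DefMap.id.snd)
        (DefPred.le DefMap.id.snd (DefMap.const _))) hR))
  have hEF : ¬ Fat {y : M | (x < y ∧ y ≤ c) ∧ ∀ t, (y < t ∧ t ≤ c) → R y t} := by
    intro hF
    obtain ⟨a, b, hab, hs⟩ := fat_iff_Ioo.1 hF
    obtain ⟨y, hy, t, ht, hyt, hnR⟩ := hc a b hab fun y hy =>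
      hsub ⟨hx.1.trans (hs hy).1.1, (hs hy).1.2.trans_lt hcq⟩
    exact hnR ((hs hy).2 t ⟨hyt, (hs ht).1.2⟩)
  obtain ⟨s, hs, hmin⟩ := hE.exists_isLeast hEF (x := c) (b := x)
    ⟨⟨hc'.1, le_rfl⟩, fun t ht => absurd ht.1 ht.2.not_gt⟩ fun y hy => hy.1.1.le
  have hsD := hDe ⟨hs.1.1, hs.1.2.trans_lt hce⟩
  have hsD' : ∃ z, (x < z ∧ z < s) ∧ ∀ t, (z < t ∧ t ≤ s) → R z t := by
    by_contra! hcon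
    exact hsD ⟨⟨hs.1.1, hs.1.2.trans_lt hcq⟩, fun z hz => by
      obtain ⟨t, ht, hn⟩ := hcon z hz; exact ⟨t, ht, hn⟩⟩
  obtain ⟨z, hz, hzR⟩ := hsD'
  refine (hmin ⟨⟨hz.1, hz.2.le.trans hs.1.2⟩, fun t ht => ?_⟩ : s ≤ z).not_gt hz.2
  rcases le_or_gt t s with hts | hts
  · exact hzR t ⟨ht.1, hts⟩
  · exact htr _ _ _ (hzR s ⟨hz.2, le_rfl⟩) (hs.2 t ⟨hts, ht.2⟩)

theorem DefPred.eventually_nhdsGT {P : Γ → M → Prop} {f : Γ → M}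
    (hP : DefPred L M (fun p : Γ × M => P p.1 p.2)) (hf : DefMap L M f) :
    DefPred L M (fun g => ∀ᶠ d in 𝓝[>] (f g), P g d) := by
  simp only [eventually_nhdsWithin_iff, mem_Ioi]
  exact DefPred.eventually_nhds ((DefPred.lt (hf.comp DefMap.id.fst) DefMap.id.snd).imp hP) hf

/-- A definable family of nonempty sets that is linearly ordered by inclusion has a point common
to the members with indices in some interval. -/
theorem exists_fat_of_chain [Nonempty Δ] {Y : M → Δ → Prop}
    (hY : DefPred L M (fun p : M × Δ => Y p.1 p.2))
    {A : M → Prop} (hA : DefPred L M A) (hF : Fat {x | A x}) (hne : ∀ x, A x → ∃ y, Y x y)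
    (hch : ∀ x t, A x → A t → (∀ y, Y x y → Y t y) ∨ (∀ y, Y t y → Y x y)) :
    ∃ y, Fat {x | A x ∧ Y x y} := by
  have hR : DefPred L M (fun p : M × M => ∀ y, Y p.1 y → Y p.2 y) :=
    DefPred.all ((hY.comp (DefMap.id.fst.fst.prodMk DefMap.id.snd)).imp
      (hY.comp (DefMap.id.fst.snd.prodMk DefMap.id.snd)))
  have hR' : DefPred L M (fun p : M × M => ∀ y, Y p.2 y → Y p.1 y) :=
    DefPred.all ((hY.comp (DefMap.id.fst.snd.prodMk DefMap.id.snd)).imp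
      (hY.comp (DefMap.id.fst.fst.prodMk DefMap.id.snd)))
  have hdef := DefPred.eventually_nhdsGT (P := fun x t => ∀ y, Y x y → Y t y) hR DefMap.id
  obtain ⟨p, q, hpq, hsub⟩ := fat_iff_Ioo.1 hF
  -- Either the family increases immediately to the right of generic points, or, by the chain
  -- condition, it decreases there. Once this is uniform on an interval, a member of one fiber
  -- persists to its right, respectively to its left.
  rcases fat_or (hA.and hdef) (hA.and hdef.not) (hF.mono fun x hx =>
    (em (∀ᶠ t in 𝓝[>] x, ∀ y, Y x y → Y t y)).imp (fun h => ⟨hx, h⟩) fun h => ⟨hx, h⟩) with h | h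
  · obtain ⟨a, b, hab, hs, H⟩ := exists_Ioo_of_transitive
      (R := fun x t => ∀ y, Y x y → Y t y) hR
      (fun x y z h1 h2 d hd => h2 d (h1 d hd)) h fun x hx => hx.2
    obtain ⟨x, hx⟩ := exists_between hab
    obtain ⟨y, hy⟩ := hne x (hs hx).1
    refine ⟨y, (fat_Ioo hx.2).mono fun t ht => ?_⟩
    have ht' : t ∈ Ioo a b := ⟨hx.1.trans ht.1, ht.2⟩
    exact ⟨(hs ht').1, H x hx t ht' ht.1 y hy⟩
  · obtain ⟨a', b', hab', hs'⟩ := fat_iff_Ioo.1 h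
    obtain ⟨a, b, hab, hs, H⟩ := exists_Ioo_of_transitive
      (R := fun x t => ∀ y, Y t y → Y x y) hR'
      (fun x y z h1 h2 d hd => h1 d (h2 d hd)) (fat_Ioo hab') fun x hx => by
        have h1 := ((hR.comp (f := fun t : M => (x, t))
          ((DefMap.const x).prodMk DefMap.id)).germ_right x).resolve_left (hs' hx).2
        filter_upwards [h1, Ioo_mem_nhdsGT hx.2] with t ht ht'
        exact (hch x t (hs' hx).1 (hs' ⟨hx.1.trans ht'.1, ht'.2⟩).1).resolve_left ht
    obtain ⟨x, hx⟩ := exists_between hab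
    obtain ⟨y, hy⟩ := hne x (hs' (hs hx)).1
    refine ⟨y, (fat_Ioo hx.1).mono fun t ht => ?_⟩
    have ht' : t ∈ Ioo a b := ⟨ht.1, ht.2.trans hx.2⟩
    exact ⟨(hs' (hs ht')).1, H t ht' x hx ht.2 y hy⟩

end

/-! ### Definable functions of one variable -/

section

variable {L : FirstOrder.Language.{u, v}} [L.IsOrdered] {M : Type w}
    [LinearOrder M] [DenselyOrdered M] [NoMinOrder M] [NoMaxOrder M] [Nonempty M]
    [TopologicalSpace M] [OrderTopology M] [L.Structure M] [L.OrderedStructure M] [Tame L M]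
variable {Γ Δ Θ : Type w} [TopologicalSpace Γ] [TopologicalSpace Δ] [TopologicalSpace Θ]
  [Tuples M Γ] [Tuples M Δ] [Tuples M Θ]

theorem isDiscrete_of_eventually {X : Type*} [TopologicalSpace X] {s : Set X}
    (h : ∀ x ∈ s, ∀ᶠ y in 𝓝 x, y ∈ s → y = x) : IsDiscrete s := by
  refine IsDiscrete.of_nhdsWithin fun x hx => ?_
  rw [nhdsWithin, ← Filter.principal_singleton, le_principal_iff, mem_inf_principal]
  exact h x hx

/-- The image of a definable discrete set under a definable function has empty interior. -/
theorem not_fat_image_of_discrete {X : Set Γ} (hX : DefPred L M (· ∈ X))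
    (hd : ∀ x ∈ X, ∀ᶠ y in 𝓝 x, y ∈ X → y = x) {h : Γ → M} (hh : DefMap L M h) :
    ¬ Fat (h '' X) := by
  intro hF
  obtain ⟨n, ⟨e⟩⟩ := Finite.exists_equiv_fin (Tuples.κ M Γ)
  -- The graph of `h`, with the value placed first. It is discrete because `X` is and the value
  -- depends on the point; its projection to coordinate `0` is the image of `h`, so property (a)
  -- applies.
  let G : Set (Fin (n + 1) → M) :=
    {v | ∃ x, x ∈ X ∧ v 0 = h x ∧ ∀ j, v (e j).succ = coord M x j}
  have hG : IsDef L G := by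
    change DefPred L M (fun v : Fin (n + 1) → M =>
      ∃ x, x ∈ X ∧ v 0 = h x ∧ ∀ j, v (e j).succ = coord M x j)
    refine DefPred.ex (DefPred.and (hX.mem DefMap.id.snd) (DefPred.and
      (DefPred.eq (DefMap.id.fst.apply 0) (hh.comp DefMap.id.snd)) (DefPred.all_finite fun j =>
        DefPred.eq (DefMap.id.fst.apply _) (DefMap.id.snd.coord j))))
  have hGne : G.Nonempty := by
    obtain ⟨_, x, hx, -⟩ := hF.nonempty
    refine ⟨Fin.cons (h x) fun j => coord M x (e.symm j), x, hx, rfl, fun j => ?_⟩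
    simp
  have hGd : IsDiscrete G := by
    refine isDiscrete_of_eventually ?_
    rintro v ⟨x, hx, hv, hvj⟩
    let r : (Fin (n + 1) → M) → Γ := fun v => Tuples.homeo.symm fun j => v (e j).succ
    have hr : ∀ v y, (∀ j, v (e j).succ = coord M y j) → r v = y := fun v y hy => by
      apply coord_ext M
      intro j
      simp [r, hy]
    have hc : ContinuousAt r v := by
      apply Continuous.continuousAt
      fun_prop
    have := hc.eventually (by rw [hr v x hvj]; exact hd x hx)
    filter_upwards [this] with v' hv' ⟨x', hx', h0, hj⟩
    rw [hr v' x' hj] at hv'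
    obtain rfl := hv' hx'
    ext i
    refine Fin.cases (h0.trans hv.symm) (fun i => ?_) i
    rw [← e.apply_symm_apply i, hj, hvj]
  have hP := Tame.discrete_proj (n + 1) 1 (Fin.castLEOrderEmb (by omega)) G hG hGne hGd
  obtain ⟨y, hy⟩ := fat_iff.1 hF
  have hmem : ∀ z ∈ h '' X, (fun _ => z : Fin 1 → M) ∈
      coordProj (Fin.castLEOrderEmb (Nat.le_add_left 1 n)) '' G := by
    rintro _ ⟨x, hx, rfl⟩
    refine ⟨Fin.cons (h x) fun j => coord M x (e.symm j), ⟨x, hx, rfl, fun j => by simp⟩, ?_⟩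
    ext i
    fin_cases i
    rfl
  have h1 := hP.nhdsWithin _ (hmem y hy.self_of_nhds)
  have h2 : ∀ᶠ v in 𝓝 (fun _ => y : Fin 1 → M),
      v ∈ coordProj (Fin.castLEOrderEmb (Nat.le_add_left 1 n)) '' G → v = fun _ => y := by
    have : {fun _ => y} ∈ 𝓝[coordProj (Fin.castLEOrderEmb (Nat.le_add_left 1 n)) '' G]
      (fun _ => y : Fin 1 → M) := by rw [h1]; simp
    rwa [mem_nhdsWithin_iff_eventually] at this
  have h3 : ∀ᶠ z in 𝓝 y, z = y := by
    have hc : ContinuousAt (fun z : M => (fun _ => z : Fin 1 → M)) y := by fun_prop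
    filter_upwards [hc.eventually h2, hy] with z hz hz'
    exact congrFun (hz (hmem z hz')) 0
  obtain ⟨a, b, hab, hs⟩ := mem_nhds_iff_exists_Ioo_subset.1 h3
  obtain ⟨z, hz⟩ := exists_between hab.2
  exact hz.1.ne' (hs ⟨hab.1.trans hz.1, hz.2⟩)

/-- A definable function on a line is continuous at generic points. -/
theorem not_fat_not_continuousAt_self {f : M → M} (hf : DefMap L M f) :
    ¬ Fat {x | ¬ ContinuousAt f x} := by
  intro hF
  -- A strictly monotone `f` is continuous somewhere. If its image had no interior it would be
  -- discrete, and the inverse would map it onto an interval. So the image is a neighbourhood of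
  -- some value, and monotonicity gives continuity there.
  have mono : ∀ a b, a < b → (∀ x ∈ Ioo a b, ¬ ContinuousAt f x) →
      ¬ (StrictMonoOn f (Ioo a b) ∨ StrictAntiOn f (Ioo a b)) := by
    intro a b hab hx hm
    have hinj : InjOn f (Ioo a b) := hm.elim (fun h => h.injOn) (fun h => h.injOn)
    have hI : DefPred L M (· ∈ Ioo a b) :=
      DefPred.and (DefPred.lt (DefMap.const a) DefMap.id) (DefPred.lt DefMap.id (DefMap.const b))
    have hK : DefPred L M (· ∈ f '' Ioo a b) := hI.image hf
    obtain ⟨g, hg, hgf⟩ := exists_defMap (R := fun y x => x ∈ Ioo a b ∧ f x = y) hK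
      ((hI.mem DefMap.id.snd).and (DefPred.eq (hf.comp DefMap.id.snd) DefMap.id.fst)) (by
        rintro _ ⟨x, hx, rfl⟩
        exact ⟨x, ⟨hx, rfl⟩, fun z hz => hinj hz.1 hx hz.2⟩)
    have hKF : Fat (f '' Ioo a b) := by
      by_contra hn
      refine not_fat_image_of_discrete hK (fun y hy => ?_) hg ((fat_Ioo hab).mono fun x hx => ?_)
      · have := eventually_nhdsWithin_iff.1 (hK.eventually_ne hn y)
        filter_upwards [this] with z hz hz'
        by_contra hne
        exact hz hne hz'
      · exact ⟨f x, mem_image_of_mem f hx, hinj (hgf _ (mem_image_of_mem f hx)).1 hx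
          (hgf _ (mem_image_of_mem f hx)).2⟩
    obtain ⟨y, hy⟩ := fat_iff.1 hKF
    obtain ⟨x, hxI, rfl⟩ := hy.self_of_nhds
    refine hx x hxI ?_
    rcases hm with hm | hm
    · exact continuousAt_of_monotoneOn_of_image_mem_nhds hm.monotoneOn
        (isOpen_Ioo.mem_nhds hxI) hy
    · exact continuousAt_of_monotoneOn_of_image_mem_nhds (β := Mᵒᵈ) hm.antitoneOn.dual_right
        (isOpen_Ioo.mem_nhds hxI) hy
  have hlt : DefPred L M (fun p : M × M => f p.1 < f p.2) :=
    DefPred.lt (hf.comp DefMap.id.fst) (hf.comp DefMap.id.snd)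
  have hgt : DefPred L M (fun p : M × M => f p.2 < f p.1) :=
    DefPred.lt (hf.comp DefMap.id.snd) (hf.comp DefMap.id.fst)
  have h1 := DefPred.eventually_nhdsGT (P := fun x t => f x < f t) hlt DefMap.id
  have h2 := DefPred.eventually_nhdsGT (P := fun x t => f t < f x) hgt DefMap.id
  obtain ⟨p, q, hpq, hsub⟩ := fat_iff_Ioo.1 hF
  have hI : DefPred L M (· ∈ Ioo p q) :=
    DefPred.and (DefPred.lt (DefMap.const p) DefMap.id) (DefPred.lt DefMap.id (DefMap.const q))
  -- To the right of each point, `f` is eventually larger, smaller or equal. One case holds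
  -- throughout an interval, and transitivity makes `f` strictly increasing, strictly decreasing or
  -- constant on a subinterval.
  have key : Fat {x | x ∈ Ioo p q ∧ ∀ᶠ t in 𝓝[>] x, f x < f t} ∨
      Fat {x | (x ∈ Ioo p q ∧ ∀ᶠ t in 𝓝[>] x, f t < f x) ∨ x ∈ Ioo p q ∧
        ((¬ ∀ᶠ t in 𝓝[>] x, f x < f t) ∧ ¬ ∀ᶠ t in 𝓝[>] x, f t < f x)} := by
    refine fat_or (hI.and h1) ((hI.and h2).or (hI.and (h1.not.and h2.not)))
      ((fat_Ioo hpq).mono fun x hx => ?_)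
    have := mem_Ioo.1 hx
    simp only [mem_Ioo, mem_ofPred_eq]
    tauto
  rcases key with h | h
  · obtain ⟨a, b, hab, hs, H⟩ := exists_Ioo_of_transitive (R := fun x t => f x < f t) hlt (fun x y z => lt_trans) h
      fun x hx => hx.2
    exact mono a b hab (fun x hx => hsub (hs hx).1) (Or.inl H)
  rcases fat_or (hI.and h2) (hI.and (h1.not.and h2.not)) h with h | h
  · obtain ⟨a, b, hab, hs, H⟩ := exists_Ioo_of_transitive (R := fun x t => f t < f x) hgt (fun x y z h h' => h'.trans h) h
      fun x hx => hx.2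
    exact mono a b hab (fun x hx => hsub (hs hx).1) (Or.inr H)
  · obtain ⟨a, b, hab, hs, H⟩ := exists_Ioo_of_transitive (R := fun x t => f x = f t)
      (DefPred.eq (hf.comp DefMap.id.fst) (hf.comp DefMap.id.snd)) (fun x y z => Eq.trans) h
      fun x hx => by
        have k1 := ((hlt.comp (f := fun t : M => (x, t))
          ((DefMap.const x).prodMk DefMap.id)).germ_right x).resolve_left hx.2.1
        have k2 := ((hgt.comp (f := fun t : M => (x, t))
          ((DefMap.const x).prodMk DefMap.id)).germ_right x).resolve_left hx.2.2
        filter_upwards [k1, k2] with t h1 h2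
        exact le_antisymm (not_lt.1 h2) (not_lt.1 h1)
    obtain ⟨x, hx⟩ := exists_between hab
    refine hsub (hs hx).1 ?_
    have : f =ᶠ[𝓝 x] fun _ => f x := by
      filter_upwards [isOpen_Ioo.mem_nhds hx] with t ht
      rcases lt_trichotomy x t with h | rfl | h
      · exact (H x hx t ht h).symm
      · rfl
      · exact H t ht x hx h
    exact continuousAt_const.congr this.symm

theorem DefPred.continuousAt_coord {f : Γ → M} (hf : DefMap L M f) :
    DefPred L M (fun x => ContinuousAt f x) := by
  have : ∀ x, ContinuousAt f x ↔ (∀ c, c < f x → ∀ᶠ y in 𝓝 x, c < f y) ∧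
      (∀ c, f x < c → ∀ᶠ y in 𝓝 x, f y < c) := fun x => tendsto_order
  simp only [this]
  refine DefPred.and (DefPred.all (DefPred.imp (DefPred.lt DefMap.id.snd (hf.comp DefMap.id.fst))
    (DefPred.eventually_nhds (P := fun (p : Γ × M) y => p.2 < f y) ?_ DefMap.id.fst)))
    (DefPred.all (DefPred.imp (DefPred.lt (hf.comp DefMap.id.fst) DefMap.id.snd)
    (DefPred.eventually_nhds (P := fun (p : Γ × M) y => f y < p.2) ?_ DefMap.id.fst)))
  · exact DefPred.lt DefMap.id.fst.snd (hf.comp DefMap.id.snd)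
  · exact DefPred.lt (hf.comp DefMap.id.snd) DefMap.id.fst.snd

theorem Fat.and_not_self {P Q : M → Prop} (h : Fat {x | P x}) (hP : DefPred L M P)
    (hQ : DefPred L M Q) (hn : ¬ Fat {x | Q x}) : Fat {x | P x ∧ ¬ Q x} :=
  (fat_or (hP.and hQ.not) hQ (h.mono fun x hx =>
    (em (Q x)).symm.imp (fun h' => ⟨hx, h'⟩) fun h' => h')).resolve_right hn

/-- Bounds for each fiber are made independent of the base point: the admissible upper bounds form
an up-set and the lower bounds a down-set, so each family is a chain and `exists_fat_of_chain`
applies. -/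
theorem exists_fat_bounded {Y : M → M → Prop} (hY : DefPred L M (fun p : M × M => Y p.1 p.2))
    (hF : Fat {x | Fat {y | Y x y}}) :
    ∃ d e, Fat {x | Fat {y | (Y x y ∧ y < e) ∧ d < y}} := by
  have hP : DefPred L M (fun p : M × M => Fat {y | Y p.1 y ∧ y < p.2}) :=
    DefPred.fat (P := fun (p : M × M) y => Y p.1 y ∧ y < p.2)
      ((hY.comp (DefMap.id.fst.fst.prodMk DefMap.id.snd)).and
        (DefPred.lt DefMap.id.snd DefMap.id.fst.snd))
  obtain ⟨e, he⟩ := exists_fat_of_chain (Y := fun x e => Fat {y | Y x y ∧ y < e}) hP hY.fat hF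
    (fun x hx => by
      obtain ⟨a, b, hab, hs⟩ := fat_iff_Ioo.1 hx
      exact ⟨b, (fat_Ioo hab).mono fun y hy => ⟨hs hy, hy.2⟩⟩)
    (fun x t hx ht => by
      by_contra! hc
      obtain ⟨⟨c, h1, h2⟩, d, h3, h4⟩ := hc
      rcases le_total c d with h | h
      · exact h4 (h1.mono fun y hy => ⟨hy.1, hy.2.trans_le h⟩)
      · exact h2 (h3.mono fun y hy => ⟨hy.1, hy.2.trans_le h⟩))
  have hA : DefPred L M (fun x => Fat {y | Y x y ∧ y < e}) :=
    hP.comp (DefMap.id.prodMk (DefMap.const e))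
  have hP' : DefPred L M (fun p : M × M => Fat {y | (Y p.1 y ∧ y < e) ∧ p.2 < y}) :=
    DefPred.fat (P := fun (p : M × M) y => (Y p.1 y ∧ y < e) ∧ p.2 < y)
      (((hY.comp (DefMap.id.fst.fst.prodMk DefMap.id.snd)).and
        (DefPred.lt DefMap.id.snd (DefMap.const e))).and
        (DefPred.lt DefMap.id.fst.snd DefMap.id.snd))
  obtain ⟨d, hd⟩ := exists_fat_of_chain (Y := fun x d => Fat {y | (Y x y ∧ y < e) ∧ d < y}) hP'
    hA (he.mono fun x hx => hx.2)
    (fun x hx => by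
      obtain ⟨a, b, hab, hs⟩ := fat_iff_Ioo.1 hx
      exact ⟨a, (fat_Ioo hab).mono fun y hy => ⟨hs hy, hy.1⟩⟩)
    (fun x t hx ht => by
      by_contra! hc
      obtain ⟨⟨c, h1, h2⟩, d, h3, h4⟩ := hc
      rcases le_total c d with h | h
      · exact h2 (h3.mono fun y hy => ⟨hy.1, h.trans_lt hy.2⟩)
      · exact h4 (h1.mono fun y hy => ⟨hy.1, h.trans_lt hy.2⟩))
  exact ⟨d, e, hd.mono fun x hx => hx.2⟩

/-- Each fiber contains an interval from `f x` to `g x` with definable ends. Where both ends are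
continuous, a value strictly between them lies in all nearby fibers. -/
theorem exists_fat_section_of_bounded {Y : M → M → Prop}
    (hY : DefPred L M (fun p : M × M => Y p.1 p.2)) {d e : M} (hYb : ∀ x y, Y x y → d < y ∧ y < e)
    (hF : Fat {x | Fat {y | Y x y}}) : ∃ y, Fat {x | Y x y} := by
  have hS : DefPred L M (fun p : M × M => ∀ᶠ z in 𝓝 p.2, Y p.1 z) :=
    DefPred.eventually_nhds (P := fun (p : M × M) z => Y p.1 z)
      (hY.comp (DefMap.id.fst.fst.prodMk DefMap.id.snd)) DefMap.id.snd
  have hSx : ∀ x, DefPred L M (fun y => ∀ᶠ z in 𝓝 y, Y x z) := fun x =>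
    hS.comp (f := fun y : M => (x, y)) ((DefMap.const x).prodMk DefMap.id)
  have hB : DefPred L M (fun x => Fat {y | Y x y}) := hY.fat
  -- `f x` is the infimum of the interior of the fiber over `x`; the bounds `d` and `e` keep it
  -- finite.
  obtain ⟨f, hf, hfB⟩ := exists_defMap (A := fun x => Fat {y | Y x y})
    (R := fun x s => (∀ y, (∀ᶠ z in 𝓝 y, Y x z) → s ≤ y) ∧
      ∀ c, (∀ y, (∀ᶠ z in 𝓝 y, Y x z) → c ≤ y) → c ≤ s) hB
    (DefPred.and (DefPred.all ((hS.comp (DefMap.id.fst.fst.prodMk DefMap.id.snd)).imp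
      (DefPred.le DefMap.id.fst.snd DefMap.id.snd))) (DefPred.all (DefPred.imp (DefPred.all
        ((hS.comp (DefMap.id.fst.fst.fst.prodMk DefMap.id.snd)).imp
      (DefPred.le DefMap.id.fst.snd DefMap.id.snd))) (DefPred.le DefMap.id.snd DefMap.id.fst.snd))))
    (by
      intro x hx
      obtain ⟨y, hy⟩ := fat_iff.1 hx
      obtain ⟨s, hs⟩ := (hSx x).exists_isGLB (b := d) hy fun y hy => (hYb x y hy.self_of_nhds).1.le
      exact ⟨s, ⟨fun y hy => hs.1 hy, fun c hc => hs.2 hc⟩,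
        fun t ht => le_antisymm (hs.2 ht.1) (ht.2 s hs.1)⟩)
  have hfS : ∀ x, Fat {y | Y x y} → ∃ b, f x < b ∧ ∀ y ∈ Ioo (f x) b, ∀ᶠ z in 𝓝 y, Y x z := by
    intro x hx
    refine mem_nhdsGT_iff_exists_Ioo_subset.1 (((hSx x).germ_right (f x)).resolve_right fun hn => ?_)
    obtain ⟨b, hb, hs⟩ := mem_nhdsGT_iff_exists_Ioo_subset.1 hn
    have hglb := hfB x hx
    have : ∃ y, (∀ᶠ z in 𝓝 y, Y x z) ∧ y < b := by
      by_contra! hc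
      exact (hglb.2 b hc).not_gt hb
    obtain ⟨y, hy, hyb⟩ := this
    rcases (hglb.1 y hy).eq_or_lt with h | h
    · have h1 : ∀ᶠ z in 𝓝[>] (f x), ∀ᶠ w in 𝓝 z, Y x w := by
        rw [h]
        exact (eventually_eventually_nhds.2 hy).filter_mono nhdsWithin_le_nhds
      obtain ⟨z, hz, hz'⟩ := (h1.and hn).exists
      exact hz' hz
    · exact hs ⟨h, hyb⟩ hy
  have hT : DefPred L M (fun p : M × M => f p.1 < p.2 ∧ p.2 ≤ e ∧
      ∀ z, f p.1 < z → z < p.2 → Y p.1 z) :=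
    DefPred.and (DefPred.lt (hf.comp DefMap.id.fst) DefMap.id.snd) (DefPred.and
      (DefPred.le DefMap.id.snd (DefMap.const e)) (DefPred.all
        (DefPred.imp (DefPred.lt (hf.comp DefMap.id.fst.fst) DefMap.id.snd)
        (DefPred.imp (DefPred.lt DefMap.id.snd DefMap.id.fst.snd)
          (hY.comp (DefMap.id.fst.fst.prodMk DefMap.id.snd))))))
  have hTne : ∀ x, Fat {y | Y x y} → ∃ y, f x < y ∧ y ≤ e ∧ ∀ z, f x < z → z < y → Y x z := by
    intro x hx
    obtain ⟨b, hb, hs⟩ := hfS x hx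
    obtain ⟨y, hy⟩ := exists_between hb
    exact ⟨y, hy.1, (hYb x y (hs y hy).self_of_nhds).2.le, fun z hz hzy =>
      (hs z ⟨hz, hzy.trans hy.2⟩).self_of_nhds⟩
  -- `g x` is the supremum of the `y ≤ e` for which the fiber contains all of `(f x, y)`.
  obtain ⟨g, hg, hgB⟩ := exists_defMap (A := fun x => Fat {y | Y x y})
    (R := fun x s => (∀ y, (f x < y ∧ y ≤ e ∧ ∀ z, f x < z → z < y → Y x z) → y ≤ s) ∧
      ∀ c, (∀ y, (f x < y ∧ y ≤ e ∧ ∀ z, f x < z → z < y → Y x z) → y ≤ c) → s ≤ c) hB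
    (DefPred.and (DefPred.all ((hT.comp (DefMap.id.fst.fst.prodMk DefMap.id.snd)).imp
      (DefPred.le DefMap.id.snd DefMap.id.fst.snd))) (DefPred.all (DefPred.imp (DefPred.all
        ((hT.comp (DefMap.id.fst.fst.fst.prodMk DefMap.id.snd)).imp
      (DefPred.le DefMap.id.snd DefMap.id.fst.snd))) (DefPred.le DefMap.id.fst.snd DefMap.id.snd))))
    (by
      intro x hx
      obtain ⟨y, hy⟩ := hTne x hx
      obtain ⟨s, hs⟩ := (hT.comp (f := fun y : M => (x, y))
        ((DefMap.const x).prodMk DefMap.id)).exists_isLUB (b := e) hy fun y hy => hy.2.1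
      exact ⟨s, ⟨fun y hy => hs.1 hy, fun c hc => hs.2 hc⟩,
        fun t ht => le_antisymm (ht.2 s hs.1) (hs.2 ht.1)⟩)
  have hC := ((hF.and_not_self hB (DefPred.continuousAt_coord hf).not
    (not_fat_not_continuousAt_self hf)).and_not_self (hB.and (DefPred.continuousAt_coord hf).not.not)
    (DefPred.continuousAt_coord hg).not (not_fat_not_continuousAt_self hg))
  obtain ⟨x, hx⟩ := fat_iff.1 hC
  have hx0 := hx.self_of_nhds
  simp only [not_not, mem_ofPred_eq] at hx0
  obtain ⟨y₀, hy₀⟩ := hTne x hx0.1.1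
  obtain ⟨y, hy1, hy2⟩ := exists_between (hy₀.1.trans_le ((hgB x hx0.1.1).1 y₀ hy₀))
  refine ⟨y, fat_iff.2 ⟨x, ?_⟩⟩
  filter_upwards [hx, hx0.1.2.eventually (gt_mem_nhds hy1), hx0.2.eventually (lt_mem_nhds hy2)]
    with t ht h1 h2
  have : ∃ y', (f t < y' ∧ y' ≤ e ∧ ∀ z, f t < z → z < y' → Y t z) ∧ y < y' := by
    by_contra! hc
    exact ((hgB t ht.1.1).2 y hc).not_gt h2
  obtain ⟨y', hy', hlt⟩ := this
  exact hy'.2.2 y h1 hlt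

/-- A definable family of sets with interior over an interval: the order of the two quantifiers
"for all points of some interval" may be exchanged. -/
theorem fat_swap_self {Y : M → M → Prop} (hY : DefPred L M (fun p : M × M => Y p.1 p.2))
    (hF : Fat {x | Fat {y | Y x y}}) : Fat {y | Fat {x | Y x y}} := by
  by_contra hn
  have hZ : DefPred L M (fun y => Fat {x | Y x y}) :=
    DefPred.fat (P := fun y x => Y x y) (hY.comp (DefMap.id.snd.prodMk DefMap.id.fst))
  -- Delete every `y` whose section has interior. If these `y` form a set without interior, the
  -- remaining fibers still have interior, so some remaining section does too, which is absurd.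
  have hY' : DefPred L M (fun p : M × M => Y p.1 p.2 ∧ ¬ Fat {x | Y x p.2}) :=
    hY.and (hZ.comp DefMap.id.snd).not
  have hF' : Fat {x | Fat {y | Y x y ∧ ¬ Fat {x | Y x y}}} := hF.mono fun x hx =>
    Fat.and_not_self hx (hY.comp (f := fun y : M => (x, y)) ((DefMap.const x).prodMk DefMap.id))
      hZ hn
  obtain ⟨d, e, hde⟩ := exists_fat_bounded (Y := fun x y => Y x y ∧ ¬ Fat {x | Y x y}) hY' hF'
  obtain ⟨y, hy⟩ := exists_fat_section_of_bounded
    (Y := fun x y => ((Y x y ∧ ¬ Fat {x | Y x y}) ∧ y < e) ∧ d < y)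
    ((hY'.and (DefPred.lt DefMap.id.snd (DefMap.const e))).and
      (DefPred.lt (DefMap.const d) DefMap.id.snd))
    (fun x y h => ⟨h.2, h.1.2⟩) hde
  obtain ⟨x, hx⟩ := hy.nonempty
  exact hx.1.1.2 (hy.mono fun x hx => hx.1.1.1)

end

/-! ### Definable sets with interior in higher dimension -/

/-- The union and quantifier exchange properties of definable subsets of `Γ` with interior. -/
structure FatCalculus (L : FirstOrder.Language.{u, v}) (M : Type w) [TopologicalSpace M]
    [L.Structure M] (Γ : Type w) [TopologicalSpace Γ] [Tuples M Γ] : Prop where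
  union : ∀ P Q : Γ → Prop, DefPred L M P → DefPred L M Q → Fat {g | P g ∨ Q g} →
    Fat {g | P g} ∨ Fat {g | Q g}
  swap : ∀ P : Γ → M → Prop, DefPred L M (fun p : Γ × M => P p.1 p.2) →
    Fat {g | Fat {m | P g m}} → Fat {m | Fat {g | P g m}}

section

variable {M : Type w} [TopologicalSpace M]

/-- A tuple indexed by `Option κ` is a tuple indexed by `κ` followed by a point. -/
def homeoOption (M : Type w) [TopologicalSpace M] (κ : Type) : (κ → M) × M ≃ₜ (Option κ → M) where
  toFun p o := o.elim p.2 p.1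
  invFun v := (fun k => v (some k), v none)
  left_inv _ := rfl
  right_inv v := by ext (_ | k) <;> rfl
  continuous_toFun := continuous_pi fun o => by cases o <;> simp <;> fun_prop
  continuous_invFun := by fun_prop

variable {L : FirstOrder.Language.{u, v}} [L.Structure M]

theorem defMap_homeoOption (κ : Type) [Finite κ] : DefMap L M (homeoOption M κ) :=
  DefMap.of_reindex _ (fun o : Option κ => o.elim (Sum.inr (0 : Fin 1)) Sum.inl)
    (by rintro p (_ | k) <;> rfl)

theorem defMap_piCongrLeft {α β : Type} [Finite α] [Finite β] (e : α ≃ β) :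
    DefMap L M (Homeomorph.piCongrLeft (Y := fun _ => M) e) := by
  refine DefMap.of_reindex _ e.symm fun g j => ?_
  obtain ⟨j, rfl⟩ := e.surjective j
  exact (Equiv.piCongrLeft_apply_apply (fun _ => M) e g j).trans
    (congrArg g (e.symm_apply_apply j).symm)

variable {Γ Δ : Type w} [TopologicalSpace Γ] [TopologicalSpace Δ] [Tuples M Γ] [Tuples M Δ]

theorem defMap_homeo_symm :
    DefMap L M ((Tuples.homeo (M := M) (Γ := Γ)).symm : (Tuples.κ M Γ → M) → Γ) :=
  DefMap.of_reindex _ (fun j => j) (fun _ _ => coord_symm M _ _)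

/-- Induction on the dimension of a space of tuples. -/
theorem Tuples.induction (L : FirstOrder.Language.{u, v}) [L.Structure M]
    {C : ∀ (Γ : Type w) [TopologicalSpace Γ] [Tuples M Γ], Prop}
    (homeo : ∀ (Γ Δ : Type w) [TopologicalSpace Γ] [TopologicalSpace Δ] [Tuples M Γ] [Tuples M Δ]
      (e : Γ ≃ₜ Δ), DefMap L M e → C Γ → C Δ)
    (empty : C (PEmpty → M))
    (prod : ∀ (Γ : Type w) [TopologicalSpace Γ] [Tuples M Γ], C Γ → C (Γ × M)) : C Γ := by
  refine homeo _ _ Tuples.homeo.symm (defMap_homeo_symm (M := M)) ?_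
  refine @Finite.induction_empty_option (fun κ => ∀ _ : Finite κ, C (κ → M)) ?_ ?_ ?_
    (Tuples.κ M Γ) inferInstance inferInstance
  · intro α β e ih _
    have := Finite.of_equiv β e.symm
    exact homeo _ _ _ (defMap_piCongrLeft e) (ih this)
  · exact fun _ => empty
  · intro α _ ih _
    exact homeo _ _ _ (defMap_homeoOption α) (prod _ (ih inferInstance))

theorem FatCalculus.of_homeomorph (H : FatCalculus L M Γ) (e : Γ ≃ₜ Δ) (he : DefMap L M e) :
    FatCalculus L M Δ where
  union P Q hP hQ h := by
    refine (H.union _ _ (hP.comp he) (hQ.comp he) (h.preimage_homeomorph e)).imp ?_ ?_ <;>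
    · intro h
      simpa using h.preimage_homeomorph e.symm
  swap P hP h := by
    refine (H.swap (fun g m => P (e g) m)
      (hP.comp ((he.comp DefMap.id.fst).prodMk DefMap.id.snd)) (h.preimage_homeomorph e)).mono ?_
    intro m hm
    simpa using Fat.preimage_homeomorph hm e.symm

theorem fat_iff_of_subsingleton {X : Type*} [TopologicalSpace X] [Subsingleton X] {s : Set X} :
    Fat s ↔ s.Nonempty := by
  refine ⟨Fat.nonempty, fun h => ?_⟩
  rw [Fat, h.eq_univ, interior_univ, ← h.eq_univ]
  exact h

theorem FatCalculus.of_subsingleton [Subsingleton Γ] : FatCalculus L M Γ where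
  union P Q _ _ h := by
    obtain ⟨g, hg⟩ := h.nonempty
    exact hg.imp (fun h => fat_iff_of_subsingleton.2 ⟨g, h⟩)
      (fun h => fat_iff_of_subsingleton.2 ⟨g, h⟩)
  swap P _ h := by
    obtain ⟨g, hg⟩ := h.nonempty
    exact Fat.mono hg fun m hm => fat_iff_of_subsingleton.2 ⟨g, hm⟩

end

/-! ### Fubini principle and generic continuity in several variables -/

section

variable {L : FirstOrder.Language.{u, v}} [L.IsOrdered] {M : Type w}
    [LinearOrder M] [DenselyOrdered M] [NoMinOrder M] [NoMaxOrder M] [Nonempty M]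
    [TopologicalSpace M] [OrderTopology M] [L.Structure M] [L.OrderedStructure M] [Tame L M]
variable {Γ Δ Θ : Type w} [TopologicalSpace Γ] [TopologicalSpace Δ] [TopologicalSpace Θ]
  [Tuples M Γ] [Tuples M Δ] [Tuples M Θ]

/-- Each fiber contains an interval `(b, c)` whose ends may vary over intervals. Two exchanges fix
`b` and then `c` independently of the base point, which yields an open box. -/
theorem FatCalculus.fat_prod (H : FatCalculus L M Γ) {P : Γ → M → Prop}
    (hP : DefPred L M (fun p : Γ × M => P p.1 p.2)) (h : Fat {g | Fat {m | P g m}}) :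
    Fat {p : Γ × M | P p.1 p.2} := by
  have hQ : DefPred L M (fun p : (Γ × M) × M => p.1.2 < p.2 ∧
      ∀ m, p.1.2 < m → m < p.2 → P p.1.1 m) :=
    (DefPred.lt DefMap.id.fst.snd DefMap.id.snd).and (DefPred.all
      ((DefPred.lt DefMap.id.fst.fst.snd DefMap.id.snd).imp
      ((DefPred.lt DefMap.id.snd DefMap.id.fst.snd).imp
      (hP.comp (DefMap.id.fst.fst.fst.prodMk DefMap.id.snd)))))
  have h1 : Fat {g | Fat {b | Fat {c | b < c ∧ ∀ m, b < m → m < c → P g m}}} := by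
    refine h.mono fun g hg => ?_
    obtain ⟨a, e, hae, hs⟩ := fat_iff_Ioo.1 hg
    refine (fat_Ioo hae).mono fun b hb => (fat_Ioo hb.2).mono fun c hc => ⟨hc.1, fun m h1 h2 => ?_⟩
    exact hs ⟨hb.1.trans h1, h2.trans hc.2⟩
  obtain ⟨b, hb⟩ := (H.swap (fun g b => Fat {c | b < c ∧ ∀ m, b < m → m < c → P g m})
    (DefPred.fat (P := fun (p : Γ × M) c => p.2 < c ∧ ∀ m, p.2 < m → m < c → P p.1 m) hQ)
    h1).nonempty
  obtain ⟨c, hc⟩ := (H.swap (fun g c => b < c ∧ ∀ m, b < m → m < c → P g m)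
    (hQ.comp (f := fun p : Γ × M => ((p.1, b), p.2))
      ((DefMap.id.fst.prodMk (DefMap.const b)).prodMk DefMap.id.snd)) hb).nonempty
  obtain ⟨g, hg⟩ := fat_iff.1 hc
  obtain ⟨m, hm⟩ := exists_between hg.self_of_nhds.1
  refine fat_iff.2 ⟨(g, m), ?_⟩
  filter_upwards [hg.prod_nhds (isOpen_Ioo.mem_nhds hm)] with p hp
  exact hp.1.2 p.2 hp.2.1 hp.2.2

/-- Both properties are checked fiberwise over `Γ`, using the one-variable results `fat_or` and
`fat_swap_self`, and reassembled with `FatCalculus.fat_prod`. -/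
theorem FatCalculus.prod (H : FatCalculus L M Γ) : FatCalculus L M (Γ × M) where
  union P Q hP hQ h := by
    have hx : ∀ {P : Γ × M → Prop}, DefPred L M P → ∀ x, DefPred L M (fun y : M => P (x, y)) :=
      fun h x => h.comp ((DefMap.const x).prodMk DefMap.id)
    have h1 : Fat {g | Fat {m | P (g, m)} ∨ Fat {m | Q (g, m)}} :=
      (Fat.fibers (P := fun g m => P (g, m) ∨ Q (g, m)) h).mono fun g hg =>
        fat_or (hx hP g) (hx hQ g) hg
    exact (H.union _ _ (DefPred.fat (P := fun g m => P (g, m)) hP)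
      (DefPred.fat (P := fun g m => Q (g, m)) hQ) h1).imp (H.fat_prod (P := fun g m => P (g, m)) hP)
      (H.fat_prod (P := fun g m => Q (g, m)) hQ)
  swap P hP h := by
    have h1 : Fat {g | Fat {m' | Fat {m | P (g, m) m'}}} := by
      refine (Fat.fibers (P := fun g m => Fat {m' | P (g, m) m'}) h).mono fun g hg => ?_
      exact fat_swap_self (Y := fun m m' => P (g, m) m')
        (hP.comp (((DefMap.const g).prodMk DefMap.id.fst).prodMk DefMap.id.snd)) hg
    have hd : DefPred L M (fun p : (Γ × M) × M => P (p.1.1, p.2) p.1.2) :=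
      hP.comp ((DefMap.id.fst.fst.prodMk DefMap.id.snd).prodMk DefMap.id.fst.snd)
    refine (H.swap (fun g m' => Fat {m | P (g, m) m'})
      (DefPred.fat (P := fun (p : Γ × M) m => P (p.1, m) p.2) hd) h1).mono fun m' hm' => ?_
    exact H.fat_prod (P := fun g m => P (g, m) m')
      (hP.comp ((DefMap.id.fst.prodMk DefMap.id.snd).prodMk (DefMap.const m'))) hm'

theorem fatCalculus : FatCalculus L M Γ :=
  Tuples.induction (C := fun Γ _ _ => FatCalculus L M Γ) L
    (fun _ _ _ _ _ _ e he H => H.of_homeomorph e he) .of_subsingleton (fun _ _ _ H => H.prod)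

/-- A definable set has interior as soon as many of its fibers have interior. -/
theorem fat_prod {P : Γ → Δ → Prop} (hP : DefPred L M (fun p : Γ × Δ => P p.1 p.2))
    (h : Fat {g | Fat {d | P g d}}) : Fat {p : Γ × Δ | P p.1 p.2} := by
  refine Tuples.induction (M := M) (Γ := Δ) (C := fun Δ _ _ =>
    ∀ (Γ : Type w) [TopologicalSpace Γ] [Tuples M Γ] (P : Γ → Δ → Prop),
      DefPred L M (fun p : Γ × Δ => P p.1 p.2) → Fat {g | Fat {d | P g d}} →
      Fat {p : Γ × Δ | P p.1 p.2}) L ?_ ?_ ?_ Γ P hP h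
  · intro Δ Δ' _ _ _ _ e he H Γ _ _ P hP h
    have := H Γ (fun g d => P g (e d))
      (hP.comp (DefMap.id.fst.prodMk (he.comp DefMap.id.snd)))
      (h.mono fun g hg => Fat.preimage_homeomorph hg e)
    simpa using this.preimage_homeomorph ((Homeomorph.refl Γ).prodCongr e.symm)
  · intro Γ _ _ P hP h
    obtain ⟨g, hg⟩ := fat_iff.1 h
    refine fat_iff.2 ⟨(g, PEmpty.elim), ?_⟩
    filter_upwards [continuous_fst.continuousAt.eventually hg] with p hp
    obtain ⟨d, hd⟩ := Fat.nonempty hp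
    rwa [Subsingleton.elim d p.2] at hd
  · intro Δ _ _ ih Γ _ _ P hP h
    have hd : DefPred L M (fun p : (Γ × Δ) × M => P p.1.1 (p.1.2, p.2)) :=
      hP.comp (DefMap.id.fst.fst.prodMk (DefMap.id.fst.snd.prodMk DefMap.id.snd))
    have h1 := ih Γ (fun g d => Fat {m | P g (d, m)})
      (DefPred.fat (P := fun (p : Γ × Δ) m => P p.1 (p.2, m)) hd)
      (h.mono fun g hg => Fat.fibers (P := fun d m => P g (d, m)) hg)
    have h2 := fatCalculus.fat_prod (P := fun (p : Γ × Δ) m => P p.1 (p.2, m)) hd h1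
    exact h2.preimage_homeomorph (Homeomorph.prodAssoc Γ Δ M).symm

theorem Fat.or {P Q : Γ → Prop} (h : Fat {g | P g ∨ Q g}) (hP : DefPred L M P)
    (hQ : DefPred L M Q) : Fat {g | P g} ∨ Fat {g | Q g} :=
  fatCalculus.union P Q hP hQ h

theorem Fat.and_not {P Q : Γ → Prop} (h : Fat {g | P g}) (hP : DefPred L M P)
    (hQ : DefPred L M Q) (hn : ¬ Fat {g | Q g}) : Fat {g | P g ∧ ¬ Q g} :=
  (Fat.or (h.mono fun x hx => (em (Q x)).symm.imp (fun h' => ⟨hx, h'⟩) fun h' => h')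
    (hP.and hQ.not) hQ).resolve_right hn

theorem Fat.exists {ι : Type*} [Finite ι] {P : ι → Γ → Prop} (h : Fat {g | ∃ i, P i g})
    (hP : ∀ i, DefPred L M (P i)) : ∃ i, Fat {g | P i g} := by
  have := Fintype.ofFinite ι
  by_contra! hn
  have key : ∀ s : Finset ι, ¬ Fat {g | ∃ i ∈ s, P i g} := by
    classical
    intro s
    induction s using Finset.induction_on with
    | empty => intro h; simpa using h.nonempty
    | insert i s hi ih =>
      intro h
      simp only [Finset.exists_mem_insert] at h
      refine (h.or (hP i) ?_).elim (hn i) ih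
      have := DefPred.ex_finite (fun i : s => hP i)
      simpa using this
  exact key Finset.univ (by simpa using h)

/-- Discontinuity at `x` is witnessed by a whole interval of levels `c`. Exchanging quantifiers
gives one `c` for an open set of `x`; there `f` lies on one side of `c` throughout, so `c` witnesses
nothing. -/
theorem not_fat_not_continuousAt_coord {f : Γ → M} (hf : DefMap L M f) :
    ¬ Fat {x | ¬ ContinuousAt f x} := by
  intro h
  have d1 : DefPred L M (fun p : Γ × M => p.2 < f p.1 ∧ ¬ ∀ᶠ y in 𝓝 p.1, p.2 < f y) :=
    (DefPred.lt DefMap.id.snd (hf.comp DefMap.id.fst)).and (DefPred.not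
      (DefPred.eventually_nhds (P := fun (p : Γ × M) y => p.2 < f y)
        (DefPred.lt DefMap.id.fst.snd (hf.comp DefMap.id.snd)) DefMap.id.fst))
  have d2 : DefPred L M (fun p : Γ × M => f p.1 < p.2 ∧ ¬ ∀ᶠ y in 𝓝 p.1, f y < p.2) :=
    (DefPred.lt (hf.comp DefMap.id.fst) DefMap.id.snd).and (DefPred.not
      (DefPred.eventually_nhds (P := fun (p : Γ × M) y => f y < p.2)
        (DefPred.lt (hf.comp DefMap.id.snd) DefMap.id.fst.snd) DefMap.id.fst))
  have h' : Fat {x | Fat {c | c < f x ∧ ¬ ∀ᶠ y in 𝓝 x, c < f y} ∨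
      Fat {c | f x < c ∧ ¬ ∀ᶠ y in 𝓝 x, f y < c}} := by
    refine h.mono fun x hx => ?_
    have : ¬ ((∀ c, c < f x → ∀ᶠ y in 𝓝 x, c < f y) ∧
      (∀ c, f x < c → ∀ᶠ y in 𝓝 x, f y < c)) := fun h' => hx (tendsto_order.2 h')
    rw [not_and_or] at this
    refine this.imp (fun h => ?_) (fun h => ?_)
    · simp only [not_forall] at h
      obtain ⟨c, hc, hn⟩ := h
      exact (fat_Ioo hc).mono fun c' hc' =>
        ⟨hc'.2, fun h => hn (h.mono fun y hy => hc'.1.trans hy)⟩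
    · simp only [not_forall] at h
      obtain ⟨c, hc, hn⟩ := h
      exact (fat_Ioo hc).mono fun c' hc' =>
        ⟨hc'.1, fun h => hn (h.mono fun y hy => hy.trans hc'.2)⟩
  rcases h'.or (DefPred.fat (P := fun x c => c < f x ∧ ¬ ∀ᶠ y in 𝓝 x, c < f y) d1)
    (DefPred.fat (P := fun x c => f x < c ∧ ¬ ∀ᶠ y in 𝓝 x, f y < c) d2) with h | h
  · obtain ⟨c, hc⟩ := (fatCalculus.swap _ d1 h).nonempty
    obtain ⟨x, hx⟩ := fat_iff.1 hc
    exact hx.self_of_nhds.2 (hx.mono fun y hy => hy.1)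
  · obtain ⟨c, hc⟩ := (fatCalculus.swap _ d2 h).nonempty
    obtain ⟨x, hx⟩ := fat_iff.1 hc
    exact hx.self_of_nhds.2 (hx.mono fun y hy => hy.1)

theorem continuousAt_iff_coord {f : Γ → Δ} {x : Γ} :
    ContinuousAt f x ↔ ∀ j, ContinuousAt (fun x => coord M (f x) j) x := by
  rw [(Tuples.homeo (M := M) (Γ := Δ)).isInducing.continuousAt_iff, continuousAt_pi]
  rfl

theorem DefPred.continuousAt_map {f : Γ → Δ} (hf : DefMap L M f) :
    DefPred L M (fun x => ContinuousAt f x) := by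
  have : ∀ x, ContinuousAt f x ↔ ∀ j, ContinuousAt (fun x => coord M (f x) j) x :=
    fun x => continuousAt_iff_coord
  simp only [this]
  exact DefPred.all_finite fun j => DefPred.continuousAt_coord (hf.coord j)

/-- A definable map is continuous at generic points. -/
theorem not_fat_not_continuousAt {f : Γ → Δ} (hf : DefMap L M f) :
    ¬ Fat {x | ¬ ContinuousAt f x} := by
  intro h
  have : ∀ x, ContinuousAt f x ↔ ∀ j, ContinuousAt (fun x => coord M (f x) j) x :=
    fun x => continuousAt_iff_coord
  simp only [this, not_forall] at h
  obtain ⟨j, hj⟩ := h.exists fun j => (DefPred.continuousAt_coord (hf.coord j)).not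
  exact not_fat_not_continuousAt_coord (hf.coord j) hj

end

/-! ### Dimension -/

section

variable {M : Type w} [TopologicalSpace M]

theorem isOpenMap_comp {ι κ : Type*} [Finite κ] {g : ι → κ} (hg : Function.Injective g) :
    IsOpenMap (fun (v : κ → M) (i : ι) => v (g i)) := by
  classical
  refine IsOpenMap.of_sections fun x => ?_
  -- A continuous section through `x`: coordinates outside the range of `g` are frozen at their
  -- values in `x`.
  refine ⟨fun w k => if h : ∃ i, g i = k then w h.choose else x k, ?_, ?_, fun w => ?_⟩
  · refine (continuous_pi fun k => ?_).continuousAt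
    by_cases h : ∃ i, g i = k
    · simpa only [h, dite_true] using continuous_apply _
    · simpa only [h, dite_false] using continuous_const
  · ext k
    by_cases h : ∃ i, g i = k
    · simp only [h, dite_true, h.choose_spec]
    · simp only [h, dite_false]
  · ext i
    have h : ∃ j, g j = g i := ⟨i, rfl⟩
    simp only [h, dite_true]
    exact congrArg w (hg h.choose_spec)

theorem Fat.preimage_snd {X Y : Type*} [TopologicalSpace X] [TopologicalSpace Y] [Nonempty X]
    {s : Set Y} (h : Fat s) : Fat (Prod.snd ⁻¹' s : Set (X × Y)) := by
  obtain ⟨y, hy⟩ := fat_iff.1 h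
  exact fat_iff.2 ⟨(Classical.arbitrary X, y), continuous_snd.continuousAt.eventually hy⟩

/-- The homeomorphism splitting off the head of a tuple. -/
def homeoCons (Γ M : Type*) [TopologicalSpace Γ] [TopologicalSpace M] (k : ℕ) :
    Γ × (Fin (k + 1) → M) ≃ₜ (Γ × M) × (Fin k → M) where
  toFun p := ((p.1, p.2 0), fun i => p.2 i.succ)
  invFun p := (p.1.1, Fin.cons p.1.2 p.2)
  left_inv p := by
    refine Prod.ext rfl ?_
    ext i
    refine Fin.cases rfl (fun i => rfl) i
  right_inv p := rfl
  continuous_toFun := by fun_prop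
  continuous_invFun := by
    refine (by fun_prop : Continuous fun p : (Γ × M) × (Fin k → M) => p.1.1).prodMk
      (continuous_pi fun i => ?_)
    refine Fin.cases ?_ (fun i => ?_) i
    · simp only [Fin.cons_zero]; fun_prop
    · simp only [Fin.cons_succ]; fun_prop

/-- The homeomorphism exchanging the last two factors. -/
def homeoSwap (A B C : Type*) [TopologicalSpace A] [TopologicalSpace B] [TopologicalSpace C] :
    (A × B) × C ≃ₜ (A × C) × B where
  toFun p := ((p.1.1, p.2), p.1.2)
  invFun p := ((p.1.1, p.2), p.1.2)
  left_inv _ := rfl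
  right_inv _ := rfl
  continuous_toFun := by fun_prop
  continuous_invFun := by fun_prop

end

/-! ### Dimension: properties that need no definability -/

section

variable {M : Type w} [LinearOrder M] [DenselyOrdered M] [NoMinOrder M] [NoMaxOrder M]
    [TopologicalSpace M] [OrderTopology M]

theorem not_fat_singleton (a : M) : ¬ Fat {a} := by
  intro h
  obtain ⟨p, q, hpq, hs⟩ := fat_iff_Ioo.1 h
  obtain ⟨x, hx⟩ := exists_between hpq
  obtain ⟨y, hy⟩ := exists_between hx.2
  have h1 : x = a := hs hx
  have h2 : y = a := hs ⟨hx.1.trans hy.1, hy.2⟩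
  exact hy.1.ne (h1.trans h2.symm)

/-- A repeated index would put the image inside a diagonal. Hence dimension can be tested with
arbitrary index maps in place of increasing ones. -/
theorem injective_of_fat {ι κ : Type*} [Finite ι] {X : Set (κ → M)} {a : ι → κ}
    (h : Fat ((fun (x : κ → M) i => x (a i)) '' X)) : Function.Injective a := by
  classical
  intro i j hij
  by_contra hne
  obtain ⟨v, hv⟩ := fat_iff.1 h
  have hc : ContinuousAt (fun m => Function.update v i m) (v i) := by fun_prop
  have h1 : ∀ᶠ m in 𝓝 (v i), m = v j := by
    have : ∀ᶠ m in 𝓝 (v i), Function.update v i m ∈ (fun (x : κ → M) i => x (a i)) '' X :=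
      hc.eventually (by simpa using hv)
    filter_upwards [this] with m ⟨x, _, hx⟩
    have h2 := congrFun hx i
    have h3 := congrFun hx j
    simp only [Function.update_self, Function.update_of_ne (Ne.symm hne)] at h2 h3
    rw [← h2, ← h3, hij]
  exact not_fat_singleton (v j) (fat_iff.2 ⟨_, h1⟩)

theorem card_le_dim {κ : Type*} [Finite κ] {n : ℕ} {X : Set (Fin n → M)} {a : κ → Fin n}
    (h : Fat ((fun (x : Fin n → M) i => x (a i)) '' X)) : (Nat.card κ : WithBot ℕ) ≤ dim X := by
  classical
  have := Fintype.ofFinite κ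
  have ha := injective_of_fat h
  have hcard : (Finset.univ.image a).card = Nat.card κ := by
    rw [Finset.card_image_of_injective _ ha, Nat.card_eq_fintype_card, Finset.card_univ]
  let e := (Finset.univ.image a).orderEmbOfFin hcard
  have he : ∀ i, ∃ k, a k = e i := fun i => by
    obtain ⟨k, -, hk⟩ := Finset.mem_image.1 ((Finset.univ.image a).orderEmbOfFin_mem hcard i)
    exact ⟨k, hk⟩
  choose τ hτ using he
  have hτi : Function.Injective τ := fun i j hij => e.injective (by rw [← hτ, ← hτ, hij])
  refine Finset.le_max (Finset.mem_filter.2 ⟨?_, e, ?_⟩)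
  · rw [Finset.mem_range, Nat.lt_succ_iff, ← hcard]
    simpa using Finset.card_le_univ (Finset.univ.image a)
  · refine (h.image_isOpenMap (isOpenMap_comp hτi)).mono ?_
    rintro _ ⟨_, ⟨x, hx, rfl⟩, rfl⟩
    exact ⟨x, hx, by ext i; simp [coordProj, hτ]⟩

/-- The working form of `dim`: indices need not be ordered, and every smaller `d` is covered because
forgetting coordinates is an open map. -/
theorem le_dim_iff {n d : ℕ} {X : Set (Fin n → M)} :
    (d : WithBot ℕ) ≤ dim X ↔ ∃ a : Fin d → Fin n, Fat ((fun (x : Fin n → M) i => x (a i)) '' X) := by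
  constructor
  · intro h
    obtain ⟨D, hD⟩ : ∃ D : ℕ, dim X = D := by
      cases hX : dim X with
      | bot => simp [hX] at h
      | coe D => exact ⟨D, rfl⟩
    rw [hD] at h
    have hdD : d ≤ D := by exact_mod_cast h
    classical
    unfold dim at hD
    obtain ⟨-, ι, hι⟩ := Finset.mem_filter.1 (Finset.mem_of_max hD)
    refine ⟨fun i => ι (Fin.castLE hdD i), ?_⟩
    have := Fat.image_isOpenMap hι (isOpenMap_comp (M := M) (Fin.castLE_injective hdD))
    rw [image_image] at this
    exact this
  · rintro ⟨a, ha⟩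
    simpa using card_le_dim ha

theorem dim_le_of_forall {n : ℕ} {X : Set (Fin n → M)} {c : WithBot ℕ}
    (h : ∀ d : ℕ, (d : WithBot ℕ) ≤ dim X → (d : WithBot ℕ) ≤ c) : dim X ≤ c := by
  cases hX : dim X with
  | bot => simp
  | coe D => exact h D hX.ge

theorem dim_mono {n : ℕ} {X Y : Set (Fin n → M)} (h : X ⊆ Y) : dim X ≤ dim Y := by
  refine dim_le_of_forall fun d hd => ?_
  obtain ⟨a, ha⟩ := le_dim_iff.1 hd
  exact le_dim_iff.2 ⟨a, ha.mono (image_mono h)⟩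

theorem zero_le_dim {n : ℕ} {X : Set (Fin n → M)} (h : X.Nonempty) : 0 ≤ dim X :=
  le_dim_iff (d := 0).2 ⟨Fin.elim0, fat_iff_of_subsingleton.2 (h.image _)⟩

theorem dim_perm_le {n : ℕ} (σ : Equiv.Perm (Fin n)) (X : Set (Fin n → M)) :
    dim ((fun (x : Fin n → M) i => x (σ i)) '' X) ≤ dim X := by
  refine dim_le_of_forall fun d hd => ?_
  obtain ⟨a, ha⟩ := le_dim_iff.1 hd
  refine le_dim_iff.2 ⟨fun i => σ (a i), ?_⟩
  rwa [image_image] at ha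

theorem dim_perm {n : ℕ} (σ : Equiv.Perm (Fin n)) (X : Set (Fin n → M)) :
    dim X = dim ((fun (x : Fin n → M) i => x (σ i)) '' X) := by
  refine le_antisymm ?_ (dim_perm_le σ X)
  have := dim_perm_le σ.symm ((fun (x : Fin n → M) i => x (σ i)) '' X)
  rw [image_image] at this
  simpa using this

/-- The indices of a witnessing projection split into those from `X` and those from `Y`; each group
witnesses a lower bound for its factor, and their sizes add up to `d`. -/
theorem dim_prodSet_le {m n : ℕ} (X : Set (Fin m → M)) (Y : Set (Fin n → M)) :
    dim (prodSet X Y) ≤ dim X + dim Y := by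
  classical
  refine dim_le_of_forall fun d hd => ?_
  obtain ⟨a, ha⟩ := le_dim_iff.1 hd
  let I := {i : Fin d // ∃ k, a i = Fin.castAdd n k}
  let J := {i : Fin d // ¬ ∃ k, a i = Fin.castAdd n k}
  have hJ : ∀ i : J, ∃ k, a i = Fin.natAdd m k := by
    rintro ⟨i, hi⟩
    change ∃ k, a i = Fin.natAdd m k
    generalize a i = z at hi
    revert hi
    exact Fin.addCases (fun k hk => absurd ⟨k, rfl⟩ hk) (fun k _ => ⟨k, rfl⟩) z
  choose b hb using fun i : I => i.2
  choose c hc using hJ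
  have h1 : (Nat.card I : WithBot ℕ) ≤ dim X := by
    refine card_le_dim (a := b) ((ha.image_isOpenMap
      (isOpenMap_comp (Subtype.val_injective (p := fun i => ∃ k, a i = Fin.castAdd n k)))).mono ?_)
    rintro _ ⟨_, ⟨_, ⟨x, hx, y, hy, rfl⟩, rfl⟩, rfl⟩
    exact ⟨x, hx, by ext i; simp [hb i]⟩
  have h2 : (Nat.card J : WithBot ℕ) ≤ dim Y := by
    refine card_le_dim (a := c) ((ha.image_isOpenMap
      (isOpenMap_comp (Subtype.val_injective (p := fun i => ¬ ∃ k, a i = Fin.castAdd n k)))).mono ?_)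
    rintro _ ⟨_, ⟨_, ⟨x, hx, y, hy, rfl⟩, rfl⟩, rfl⟩
    exact ⟨y, hy, by ext i; simp [hc i]⟩
  have h3 : d = Nat.card I + Nat.card J := by
    rw [← Nat.card_sum, Nat.card_congr (Equiv.sumCompl _), Nat.card_eq_fintype_card,
      Fintype.card_fin]
  rw [h3]
  push_cast
  exact add_le_add h1 h2

theorem le_dim_prodSet {m n : ℕ} (X : Set (Fin m → M)) (Y : Set (Fin n → M)) :
    dim X + dim Y ≤ dim (prodSet X Y) := by
  cases hX : dim X with
  | bot => simp
  | coe p =>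
    cases hY : dim Y with
    | bot => simp
    | coe q =>
      obtain ⟨a, ha⟩ := le_dim_iff.1 hX.ge
      obtain ⟨b, hb⟩ := le_dim_iff.1 hY.ge
      have : ((p + q : ℕ) : WithBot ℕ) ≤ dim (prodSet X Y) := by
        refine le_dim_iff.2
          ⟨Fin.append (fun i => Fin.castAdd n (a i)) (fun i => Fin.natAdd m (b i)), ?_⟩
        have hab : Fat (((fun (x : Fin m → M) i => x (a i)) '' X) ×ˢ
            ((fun (x : Fin n → M) i => x (b i)) '' Y)) := by
          rw [Fat, interior_prod_eq]
          exact ha.prod hb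
        refine (hab.image_homeomorph (Fin.appendHomeomorph p q)).mono ?_
        rintro _ ⟨⟨_, _⟩, ⟨⟨x, hx, rfl⟩, ⟨y, hy, rfl⟩⟩, rfl⟩
        refine ⟨Fin.append x y, ⟨x, hx, y, hy, rfl⟩, ?_⟩
        ext i
        refine Fin.addCases (fun i => ?_) (fun i => ?_) i <;> simp [Fin.appendHomeomorph]
      exact_mod_cast this

end

/-! ### Dimension of unions and of definable images -/

section

variable {L : FirstOrder.Language.{u, v}} [L.IsOrdered] {M : Type w}
    [LinearOrder M] [DenselyOrdered M] [NoMinOrder M] [NoMaxOrder M] [Nonempty M]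
    [TopologicalSpace M] [OrderTopology M] [L.Structure M] [L.OrderedStructure M] [Tame L M]
variable {Γ Δ Θ : Type w} [TopologicalSpace Γ] [TopologicalSpace Δ] [TopologicalSpace Θ]
  [Tuples M Γ] [Tuples M Δ] [Tuples M Θ]

theorem defMap_proj {n : ℕ} {κ : Type} [Finite κ] (a : κ → Fin n) :
    DefMap L M (fun (x : Fin n → M) i => x (a i)) :=
  DefMap.pi (f := fun i (x : Fin n → M) => x (a i)) fun i => DefMap.id.apply (a i)

theorem defPred_mem_iff {n : ℕ} {X : Set (Fin n → M)} : DefPred L M (· ∈ X) ↔ IsDef L X := by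
  have h : {v : Tuples.κ M (Fin n → M) → M | (Tuples.homeo.symm v : Fin n → M) ∈ X} = X :=
    Set.ext fun _ => Iff.rfl
  exact iff_of_eq (congrArg (Set.Definable univ L) h)

theorem IsDef.defPred {n : ℕ} {X : Set (Fin n → M)} (hX : IsDef L X) : DefPred L M (· ∈ X) :=
  defPred_mem_iff.2 hX

theorem dim_union {n : ℕ} {X Y : Set (Fin n → M)} (hX : IsDef L X) (hY : IsDef L Y) :
    dim (X ∪ Y) = max (dim X) (dim Y) := by
  refine le_antisymm (dim_le_of_forall fun d hd => ?_)
    (max_le (dim_mono subset_union_left) (dim_mono subset_union_right))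
  obtain ⟨a, ha⟩ := le_dim_iff.1 hd
  rw [image_union] at ha
  rw [le_max_iff, le_dim_iff, le_dim_iff]
  exact (Fat.or ha (hX.defPred.image (defMap_proj a))
    (hY.defPred.image (defMap_proj a))).imp (fun h => ⟨a, h⟩) fun h => ⟨a, h⟩

/-- A definable set all of whose coordinate images have empty interior is closed and discrete. -/
theorem eventually_eq_of_not_fat {X : Set Θ} (hX : DefPred L M (· ∈ X))
    (h : ∀ j, ¬ Fat {m | ∃ x, x ∈ X ∧ coord M x j = m}) (p : Θ) :
    ∀ᶠ x in 𝓝 p, x ∈ X → x = p := by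
  have hj : ∀ j, ∀ᶠ x in 𝓝 p, x ∈ X → coord M x j = coord M p j := fun j => by
    have hd : DefPred L M (fun m => ∃ x, x ∈ X ∧ coord M x j = m) :=
      DefPred.ex ((hX.mem DefMap.id.snd).and (DefPred.eq (DefMap.id.snd.coord j) DefMap.id.fst))
    have := eventually_nhdsWithin_iff.1 (hd.eventually_ne (h j) (coord M p j))
    filter_upwards [(continuous_coord M j).continuousAt.eventually this] with x hx hxX
    by_contra hne
    exact hx hne ⟨x, hxX, rfl⟩
  filter_upwards [eventually_all.2 hj] with x hx hxX
  exact coord_ext M fun j => hx j hxX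

theorem exists_fat_coord {X : Set Θ} (hX : DefPred L M (· ∈ X)) {q : Θ → Γ} (hq : DefMap L M q)
    (h : Fat {u | ∃ j, Fat {m | ∃ x, (x ∈ X ∧ q x = u) ∧ coord M x j = m}}) :
    ∃ j, Fat {p : Γ × M | ∃ x, (x ∈ X ∧ q x = p.1) ∧ coord M x j = p.2} := by
  have hd : ∀ j, DefPred L M (fun p : Γ × M => ∃ x, (x ∈ X ∧ q x = p.1) ∧ coord M x j = p.2) :=
    fun j => DefPred.ex (((hX.mem DefMap.id.snd).and (DefPred.eq (hq.comp DefMap.id.snd)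
      DefMap.id.fst.fst)).and (DefPred.eq (DefMap.id.snd.coord j) DefMap.id.fst.snd))
  obtain ⟨j, hj⟩ := h.exists fun j =>
    DefPred.fat (P := fun u m => ∃ x, (x ∈ X ∧ q x = u) ∧ coord M x j = m) (hd j)
  exact ⟨j, fat_prod (hd j) hj⟩

/-- If no coordinate filled an interval on the fiber of `q`, that fiber would be discrete and `h`
could not fill an interval either. A coordinate thus takes the role of `h` over generic points, and
by Fubini over an open set. -/
theorem exists_fat_exchange {X : Set Θ} (hX : DefPred L M (· ∈ X)) {q : Θ → Γ}
    (hq : DefMap L M q) {h : Θ → M} (hh : DefMap L M h)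
    (hF : Fat {p : Γ × M | ∃ x, (x ∈ X ∧ q x = p.1) ∧ h x = p.2}) :
    ∃ j, Fat {p : Γ × M | ∃ x, (x ∈ X ∧ q x = p.1) ∧ coord M x j = p.2} := by
  refine exists_fat_coord hX hq ((Fat.fibers
    (P := fun u m => ∃ x, (x ∈ X ∧ q x = u) ∧ h x = m) hF).mono fun u hu => ?_)
  by_contra! hn
  have hXu : DefPred L M (· ∈ {x | x ∈ X ∧ q x = u}) :=
    hX.and (DefPred.eq hq (DefMap.const u))
  exact not_fat_image_of_discrete hXu
    (fun x _ => eventually_eq_of_not_fat hXu (fun j hj => hn ⟨j, hj⟩) x) hh hu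

/-- The components of `h` are exchanged for coordinates one at a time. The base `Γ` is arbitrary
because it must carry the coordinates already obtained. -/
theorem exists_fat_exchange_tuple {X : Set Θ} (hX : DefPred L M (· ∈ X)) (k : ℕ) :
    ∀ (Γ : Type w) [TopologicalSpace Γ] [Tuples M Γ] {q : Θ → Γ} (_ : DefMap L M q)
      {h : Θ → Fin k → M} (_ : DefMap L M h)
      (_ : Fat {p : Γ × (Fin k → M) | ∃ x, (x ∈ X ∧ q x = p.1) ∧ h x = p.2}),
    ∃ a : Fin k → Tuples.κ M Θ,
      Fat {p : Γ × (Fin k → M) | ∃ x, (x ∈ X ∧ q x = p.1) ∧ (fun i => coord M x (a i)) = p.2} := by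
  induction k with
  | zero =>
    intro Γ _ _ q _ h _ hF
    refine ⟨Fin.elim0, hF.mono ?_⟩
    rintro p ⟨x, hx, -⟩
    exact ⟨x, hx, Subsingleton.elim _ _⟩
  | succ k ih =>
    intro Γ _ _ q hq h hh hF
    have htail : DefMap L M (fun x (i : Fin k) => h x i.succ) :=
      DefMap.pi (f := fun (i : Fin k) x => h x i.succ) fun i => hh.apply i.succ
    -- While the head of `h` is exchanged, its tail is kept in the base; afterwards the new
    -- coordinate moves into the base and the tail becomes the new tuple.
    have h1 := hF.preimage_homeomorph
      ((homeoSwap Γ (Fin k → M) M).trans (homeoCons Γ M k).symm)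
    obtain ⟨j, hj⟩ := exists_fat_exchange hX (hq.prodMk htail) (hh.apply 0) (h1.mono (by
      rintro ⟨⟨g, v⟩, m⟩ ⟨x, ⟨hx, hxq⟩, hxh⟩
      have hxh' : h x = Fin.cons m v := hxh
      refine ⟨x, ⟨hx, Prod.ext hxq ?_⟩, ?_⟩
      · ext i
        simp [hxh']
      · simp [hxh']))
    have h2 := hj.preimage_homeomorph (homeoSwap Γ M (Fin k → M))
    obtain ⟨a, ha⟩ := ih (Γ × M) (hq.prodMk (DefMap.id.coord j)) htail (h2.mono (by
      rintro ⟨⟨g, m⟩, v⟩ ⟨x, ⟨hx, hxq⟩, hxh⟩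
      have h3 := Prod.ext_iff.1 hxq
      exact ⟨x, ⟨hx, Prod.ext h3.1 hxh⟩, h3.2⟩))
    refine ⟨Fin.cons j a, (ha.preimage_homeomorph (homeoCons Γ M k)).mono ?_⟩
    rintro ⟨g, v⟩ ⟨x, ⟨hx, hxq⟩, hxh⟩
    have h3 := Prod.ext_iff.1 hxq
    refine ⟨x, ⟨hx, h3.1⟩, ?_⟩
    ext i
    refine Fin.cases h3.2 (fun i => congrFun hxh i) i

theorem dim_image_le {m n : ℕ} {X : Set (Fin m → M)} (hX : IsDef L X)
    {F : (Fin m → M) → (Fin n → M)} (hF : DefMap L M F) : dim (F '' X) ≤ dim X := by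
  refine dim_le_of_forall fun d hd => ?_
  obtain ⟨a, ha⟩ := le_dim_iff.1 hd
  rw [image_image] at ha
  obtain ⟨b, hb⟩ := exists_fat_exchange_tuple hX.defPred d (PEmpty → M)
    (q := fun _ => PEmpty.elim) (DefMap.const _) ((defMap_proj a).comp hF)
    (ha.preimage_snd.mono (by
      rintro p ⟨x, hx, hxp⟩
      exact ⟨x, ⟨hx, Subsingleton.elim _ _⟩, hxp⟩))
  refine le_dim_iff.2 ⟨b, (hb.image_isOpenMap isOpenMap_snd).mono ?_⟩
  rintro _ ⟨p, ⟨x, ⟨hx, -⟩, hxp⟩, rfl⟩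
  exact ⟨x, hx, hxp⟩

end

/-! ### Frontiers and discontinuities -/

section

variable {M : Type w} [LinearOrder M] [TopologicalSpace M] {Γ : Type w} [TopologicalSpace Γ]
  [Tuples M Γ]

theorem Below.trans {a b c : Γ} (h : Below M a b) (h' : Below M b c) : Below M a c :=
  fun j => (h j).trans (h' j)

theorem Below.exists_between [DenselyOrdered M] {a b : Γ} (h : Below M a b) :
    ∃ c, Below M a c ∧ Below M c b := by
  choose f hf using fun j => _root_.exists_between (h j)
  exact ⟨Tuples.homeo.symm f, fun j => by simpa using (hf j).1, fun j => by simpa using (hf j).2⟩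

theorem Below.fat_box [DenselyOrdered M] [NoMinOrder M] [NoMaxOrder M] [OrderTopology M]
    {a b : Γ} (h : Below M a b) : Fat {c | Below M a c ∧ Below M c b} := by
  obtain ⟨c, h1, h2⟩ := h.exists_between
  exact fat_iff.2 ⟨c, (eventually_below_right M c a h1).and (eventually_below_left M c b h2)⟩

end

section

variable {L : FirstOrder.Language.{u, v}} [L.IsOrdered] {M : Type w}
    [LinearOrder M] [DenselyOrdered M] [NoMinOrder M] [NoMaxOrder M] [Nonempty M]
    [TopologicalSpace M] [OrderTopology M] [L.Structure M] [L.OrderedStructure M] [Tame L M]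
variable {Γ Δ Θ : Type w} [TopologicalSpace Γ] [TopologicalSpace Δ] [TopologicalSpace Θ]
  [Tuples M Γ] [Tuples M Δ] [Tuples M Θ]

/-- If every point of a set with interior has a box with a definable property inherited by smaller
boxes around some point, then one box works for all points of some open set. -/
theorem exists_uniform_box {V : Γ → Prop} {B : Γ → Θ → Θ → Prop}
    (hB : DefPred L M (fun p : Γ × Θ × Θ => B p.1 p.2.1 p.2.2)) (hV : Fat {u | V u})
    (h : ∀ u, V u → ∃ x b₀ c₀, (Below M b₀ x ∧ Below M x c₀) ∧
      ∀ b c, Below M b₀ b → Below M b x → Below M x c → Below M c c₀ → B u b c) :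
    ∃ b c, Fat {u | B u b c} := by
  have h1 : Fat {u | Fat {p : Θ × Θ | B u p.1 p.2}} := by
    refine hV.mono fun u hu => ?_
    obtain ⟨x, b₀, c₀, ⟨h1, h2⟩, h3⟩ := h u hu
    -- Shrinking the box around `x` leaves freedom in both corners, so the admissible pairs of
    -- corners have interior. Fubini, read in the other order, then fixes one pair.
    have : Fat ({b | Below M b₀ b ∧ Below M b x} ×ˢ {c | Below M x c ∧ Below M c c₀}) := by
      rw [Fat, interior_prod_eq]
      exact h1.fat_box.prod h2.fat_box
    exact this.mono fun p hp => h3 _ _ hp.1.1 hp.1.2 hp.2.1 hp.2.2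
  have h2 := (fat_prod (P := fun u (p : Θ × Θ) => B u p.1 p.2) hB h1).preimage_homeomorph
    (Homeomorph.prodComm (Θ × Θ) Γ)
  obtain ⟨p, hp⟩ := (Fat.fibers (P := fun (p : Θ × Θ) u => B u p.1 p.2) h2).nonempty
  exact ⟨p.1, p.2, hp⟩

theorem defPred_coord_fibers {X : Set Θ} (hX : DefPred L M (· ∈ X)) {q : Θ → Γ}
    (hq : DefMap L M q) (j : Tuples.κ M Θ) :
    DefPred L M (fun u => Fat {m | ∃ x, (x ∈ X ∧ q x = u) ∧ coord M x j = m}) :=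
  DefPred.fat (P := fun u m => ∃ x, (x ∈ X ∧ q x = u) ∧ coord M x j = m)
    (DefPred.ex (((hX.mem DefMap.id.snd).and (DefPred.eq (hq.comp DefMap.id.snd)
      DefMap.id.fst.fst)).and (DefPred.eq (DefMap.id.snd.coord j) DefMap.id.fst.snd)))

/-- The generic fibers of a definable set over a coordinate space of the same dimension are
discrete. -/
theorem not_fat_fibers {n d : ℕ} {X : Set (Fin n → M)} (hX : IsDef L X) (hd : dim X = d)
    (a : Fin d → Fin n) :
    ¬ Fat {u : Fin d → M | ∃ j, Fat {m | ∃ x, (x ∈ X ∧ (fun i => x (a i)) = u) ∧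
      coord M x j = m}} := by
  intro h
  obtain ⟨j, hj⟩ := exists_fat_coord hX.defPred (defMap_proj a) h
  have : ((d + 1 : ℕ) : WithBot ℕ) ≤ dim X := by
    -- The index `j` together with the `d` indices of `a` would give dimension at least `d + 1`.
    refine le_dim_iff.2 ⟨Fin.append a fun _ : Fin 1 => j, ?_⟩
    refine (hj.image_homeomorph (((Homeomorph.refl _).prodCongr
      (Homeomorph.funUnique (Fin 1) M).symm).trans (Fin.appendHomeomorph d 1))).mono ?_
    rintro _ ⟨⟨u, m⟩, ⟨x, ⟨hx, hxu⟩, hxm⟩, rfl⟩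
    refine ⟨x, hx, ?_⟩
    subst hxu hxm
    ext i
    refine Fin.addCases (fun i => ?_) (fun i => ?_) i
    · simp [Fin.appendHomeomorph]
    · simp [Fin.appendHomeomorph]
      rfl
  rw [hd] at this
  have : d + 1 ≤ d := by exact_mod_cast this
  omega

/-- Isolation is asserted at every point `p` of the ambient space, not only at points of `X`,
because it is also applied to frontier points. -/
theorem fat_generic {n d : ℕ} {X Y : Set (Fin n → M)} (hX : IsDef L X) (hd : dim X = d)
    (hY : IsDef L Y) {a : Fin d → Fin n} (h : Fat ((fun (x : Fin n → M) i => x (a i)) '' Y)) :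
    Fat {u : Fin d → M | (∃ y, y ∈ Y ∧ (fun i => y (a i)) = u) ∧
      ∀ p, ∀ᶠ x in 𝓝 p, (x ∈ X ∧ (fun i => x (a i)) = u) → x = p} := by
  refine (Fat.and_not (L := L) (P := (· ∈ (fun (x : Fin n → M) i => x (a i)) '' Y)) h
    (hY.defPred.image (defMap_proj a))
    (DefPred.ex_finite fun j => defPred_coord_fibers hX.defPred (defMap_proj a) j)
    (not_fat_fibers hX hd a)).mono ?_
  rintro u ⟨⟨y, hy, hyu⟩, hn⟩
  have hXu : DefPred L M (· ∈ {x | x ∈ X ∧ (fun i => x (a i)) = u}) :=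
    hX.defPred.and (DefPred.eq (defMap_proj a) (DefMap.const u))
  exact ⟨⟨y, hy, hyu⟩, fun p => eventually_eq_of_not_fat hXu (fun j hj => hn ⟨j, hj⟩) p⟩

theorem dim_lt_of_not_le {n d : ℕ} {X : Set (Fin n → M)} {c : WithBot ℕ} (hc : c = d)
    (h : ¬ (d : WithBot ℕ) ≤ dim X) : dim X < c := by
  rw [hc]; exact not_le.1 h

theorem exists_dim_eq {n : ℕ} {X : Set (Fin n → M)} (h : X.Nonempty) : ∃ d : ℕ, dim X = d := by
  have := zero_le_dim h
  cases hX : dim X with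
  | bot => simp [hX] at this
  | coe d => exact ⟨d, rfl⟩

/-- Otherwise generic `u` has a frontier point above it. As this point is not in `X` and the fiber
of `X` is closed and discrete, some box around it misses that fiber. A common box for an open set of
`u` then misses all of `X` near one of these points. -/
theorem dim_closure_diff_lt {n : ℕ} {X : Set (Fin n → M)} (hX : IsDef L X) (hne : X.Nonempty) :
    dim (closure X \ X) < dim X := by
  obtain ⟨d, hd⟩ := exists_dim_eq hne
  refine dim_lt_of_not_le hd fun hle => ?_
  obtain ⟨a, ha⟩ := le_dim_iff.1 hle
  have hY : DefPred L M (fun p => p ∈ closure X \ X) := by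
    simp only [Set.mem_sdiff, mem_closure_iff_frequently, Filter.Frequently]
    exact (DefPred.not (DefPred.eventually_nhds (P := fun _ x => x ∉ X)
      (hX.defPred.mem DefMap.id.snd).not DefMap.id)).and hX.defPred.not
  have hV := fat_generic hX hd (Y := closure X \ X) (defPred_mem_iff.1 hY) ha
  have hB : DefPred L M (fun p : (Fin d → M) × (Fin n → M) × (Fin n → M) =>
      (∃ y, (y ∈ closure X \ X ∧ (fun i => y (a i)) = p.1) ∧ Below M p.2.1 y ∧ Below M y p.2.2) ∧
      ∀ x, (x ∈ X ∧ (fun i => x (a i)) = p.1) → ¬ (Below M p.2.1 x ∧ Below M x p.2.2)) := by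
    refine DefPred.and (DefPred.ex (DefPred.and (DefPred.and (hY.comp DefMap.id.snd)
      (DefPred.eq ((defMap_proj a).comp DefMap.id.snd) DefMap.id.fst.fst)) (DefPred.and
      (DefPred.below DefMap.id.fst.snd.fst DefMap.id.snd)
      (DefPred.below DefMap.id.snd DefMap.id.fst.snd.snd)))) (DefPred.all (DefPred.imp
      (DefPred.and (hX.defPred.mem DefMap.id.snd)
      (DefPred.eq ((defMap_proj a).comp DefMap.id.snd) DefMap.id.fst.fst)) (DefPred.not
      (DefPred.and (DefPred.below DefMap.id.fst.snd.fst DefMap.id.snd)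
      (DefPred.below DefMap.id.snd DefMap.id.fst.snd.snd)))))
  obtain ⟨b, c, hbc⟩ := exists_uniform_box (B := fun u b c =>
      (∃ y, (y ∈ closure X \ X ∧ (fun i => y (a i)) = u) ∧ Below M b y ∧ Below M y c) ∧
      ∀ x, (x ∈ X ∧ (fun i => x (a i)) = u) → ¬ (Below M b x ∧ Below M x c)) hB hV (by
    rintro u ⟨⟨p, hp, hpu⟩, hu⟩
    obtain ⟨b₀, c₀, hbc, h⟩ := (eventually_nhds_iff_box M).1 (hu p)
    refine ⟨p, b₀, c₀, hbc, fun b c h1 h2 h3 h4 => ⟨⟨p, ⟨hp, hpu⟩, h2, h3⟩, fun x hx hxb => ?_⟩⟩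
    have := h x ⟨h1.trans hxb.1, hxb.2.trans h4⟩ hx
    exact hp.2 (this ▸ hx.1))
  obtain ⟨u, hu⟩ := fat_iff.1 hbc
  obtain ⟨⟨p, ⟨hp, rfl⟩, hpb, hpc⟩, -⟩ := hu.self_of_nhds
  have hcont : ContinuousAt (fun (x : Fin n → M) i => x (a i)) p :=
    (continuous_pi fun i => continuous_apply (a i)).continuousAt
  obtain ⟨x, hxX, hx1, hx2, hx3⟩ := ((mem_closure_iff_frequently.1 hp.1).and_eventually
    ((hcont.eventually hu).and ((eventually_below_right M p b hpb).and
      (eventually_below_left M p c hpc)))).exists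
  exact hx1.2 x ⟨hxX, rfl⟩ ⟨hx2, hx3⟩

/-- Otherwise one box contains, for all `u` in an open set, exactly one point of `X` over `u`, and
this point is a discontinuity. That contradicts generic continuity of `F` along the resulting
section. -/
theorem dim_not_continuousWithinAt_lt {m n : ℕ} {X : Set (Fin m → M)} (hX : IsDef L X)
    (hne : X.Nonempty) {F : (Fin m → M) → (Fin n → M)} (hF : DefMap L M F) :
    dim {x | x ∈ X ∧ ¬ ContinuousWithinAt F X x} < dim X := by
  obtain ⟨d, hd⟩ := exists_dim_eq hne
  refine dim_lt_of_not_le hd fun hle => ?_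
  obtain ⟨a, ha⟩ := le_dim_iff.1 hle
  have hY : DefPred L M (fun x => x ∈ X ∧ ¬ ContinuousWithinAt F X x) := by
    have : ∀ x, ContinuousWithinAt F X x ↔ ∀ j,
        (∀ c, c < F x j → ∀ᶠ y in 𝓝 x, y ∈ X → c < F y j) ∧
        (∀ c, F x j < c → ∀ᶠ y in 𝓝 x, y ∈ X → F y j < c) := fun x => by
      rw [continuousWithinAt_pi]
      refine forall_congr' fun j => ?_
      simp only [← eventually_nhdsWithin_iff]
      exact tendsto_order
    simp only [this]
    refine hX.defPred.and (DefPred.not (DefPred.all_finite fun j => DefPred.and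
      (DefPred.all (DefPred.imp
      (DefPred.lt DefMap.id.snd ((hF.comp DefMap.id.fst).apply j)) (DefPred.eventually_nhds
      (P := fun (p : (Fin m → M) × M) y => y ∈ X → p.2 < F y j) ((hX.defPred.mem DefMap.id.snd).imp
      (DefPred.lt DefMap.id.fst.snd ((hF.comp DefMap.id.snd).apply j))) DefMap.id.fst)))
      (DefPred.all (DefPred.imp
      (DefPred.lt ((hF.comp DefMap.id.fst).apply j) DefMap.id.snd) (DefPred.eventually_nhds
      (P := fun (p : (Fin m → M) × M) y => y ∈ X → F y j < p.2) ((hX.defPred.mem DefMap.id.snd).imp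
      (DefPred.lt ((hF.comp DefMap.id.snd).apply j) DefMap.id.fst.snd)) DefMap.id.fst)))))
  have hV := fat_generic hX hd (Y := {x | x ∈ X ∧ ¬ ContinuousWithinAt F X x})
    (defPred_mem_iff.1 hY) ha
  have hmem : DefPred L M (fun p : ((Fin d → M) × (Fin m → M) × (Fin m → M)) × (Fin m → M) =>
      (p.2 ∈ X ∧ (fun i => p.2 (a i)) = p.1.1) ∧ Below M p.1.2.1 p.2 ∧ Below M p.2 p.1.2.2) :=
    DefPred.and (DefPred.and (hX.defPred.mem DefMap.id.snd)
      (DefPred.eq ((defMap_proj a).comp DefMap.id.snd) DefMap.id.fst.fst)) (DefPred.and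
      (DefPred.below DefMap.id.fst.snd.fst DefMap.id.snd)
      (DefPred.below DefMap.id.snd DefMap.id.fst.snd.snd))
  have hB : DefPred L M (fun p : (Fin d → M) × (Fin m → M) × (Fin m → M) =>
      (∃ y, ((y ∈ X ∧ ¬ ContinuousWithinAt F X y) ∧ (fun i => y (a i)) = p.1) ∧
        Below M p.2.1 y ∧ Below M y p.2.2) ∧
      ∀ x y, ((x ∈ X ∧ (fun i => x (a i)) = p.1) ∧ Below M p.2.1 x ∧ Below M x p.2.2) →
        ((y ∈ X ∧ (fun i => y (a i)) = p.1) ∧ Below M p.2.1 y ∧ Below M y p.2.2) → x = y) := by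
    refine DefPred.and (DefPred.ex (DefPred.and (DefPred.and (hY.comp DefMap.id.snd)
      (DefPred.eq ((defMap_proj a).comp DefMap.id.snd) DefMap.id.fst.fst)) (DefPred.and
      (DefPred.below DefMap.id.fst.snd.fst DefMap.id.snd)
      (DefPred.below DefMap.id.snd DefMap.id.fst.snd.snd)))) (DefPred.all (DefPred.all
      (DefPred.imp (hmem.comp (DefMap.id.fst.fst.prodMk DefMap.id.fst.snd)) (DefPred.imp
      (hmem.comp (DefMap.id.fst.fst.prodMk DefMap.id.snd))
      (DefPred.eq DefMap.id.fst.snd DefMap.id.snd)))))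
  obtain ⟨b, c, hbc⟩ := exists_uniform_box (B := fun u b c =>
      (∃ y, ((y ∈ X ∧ ¬ ContinuousWithinAt F X y) ∧ (fun i => y (a i)) = u) ∧
        Below M b y ∧ Below M y c) ∧
      ∀ x y, ((x ∈ X ∧ (fun i => x (a i)) = u) ∧ Below M b x ∧ Below M x c) →
        ((y ∈ X ∧ (fun i => y (a i)) = u) ∧ Below M b y ∧ Below M y c) → x = y) hB hV (by
    rintro u ⟨⟨p, hp, hpu⟩, hu⟩
    obtain ⟨b₀, c₀, hbc, h⟩ := (eventually_nhds_iff_box M).1 (hu p)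
    refine ⟨p, b₀, c₀, hbc, fun b c h1 h2 h3 h4 => ⟨⟨p, ⟨hp, hpu⟩, h2, h3⟩,
      fun x y hx hy => ?_⟩⟩
    rw [h x ⟨h1.trans hx.2.1, hx.2.2.trans h4⟩ hx.1, h y ⟨h1.trans hy.2.1, hy.2.2.trans h4⟩ hy.1])
  have hBbc := hB.comp (f := fun u : Fin d → M => (u, b, c))
    (DefMap.id.prodMk (DefMap.const (b, c)))
  -- The definable section sending `u` to the unique point of `X` over `u` inside the box.
  obtain ⟨τ, hτ, hτX⟩ := exists_defMap (R := fun (u : Fin d → M) (x : Fin m → M) =>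
      (x ∈ X ∧ (fun i => x (a i)) = u) ∧ Below M b x ∧ Below M x c) hBbc
    (hmem.comp (f := fun p : (Fin d → M) × (Fin m → M) => ((p.1, b, c), p.2))
      ((DefMap.id.fst.prodMk (DefMap.const (b, c))).prodMk DefMap.id.snd)) (by
    rintro u ⟨⟨y, hy, hyb⟩, hu⟩
    exact ⟨y, ⟨⟨hy.1.1, hy.2⟩, hyb⟩, fun z hz => hu z y hz ⟨⟨hy.1.1, hy.2⟩, hyb⟩⟩)
  obtain ⟨u, hu⟩ := fat_iff.1 (Fat.and_not hbc hBbc (DefPred.continuousAt_map (hF.comp hτ)).not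
    (not_fat_not_continuousAt (hF.comp hτ)))
  obtain ⟨⟨⟨p, ⟨⟨hpX, hpn⟩, rfl⟩, hpb⟩, huniq⟩, hcont⟩ := hu.self_of_nhds
  have hproj : ContinuousAt (fun (x : Fin m → M) i => x (a i)) p :=
    (continuous_pi fun i => continuous_apply (a i)).continuousAt
  have hcomp : ContinuousAt (fun x : Fin m → M => F (τ fun i => x (a i))) p :=
    ContinuousAt.comp (g := fun u => F (τ u)) (f := fun (x : Fin m → M) i => x (a i))
      (not_not.1 hcont) hproj
  -- Near `p`, every point of `X` is the value of `τ` at its projection, so `F` agrees on `X` with a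
  -- map continuous at `p`.
  refine hpn (hcomp.continuousWithinAt.congr_of_eventuallyEq ?_ ?_)
  · refine eventually_nhdsWithin_iff.2 ?_
    filter_upwards [hproj.eventually hu, eventually_below_right M p b hpb.1,
      eventually_below_left M p c hpb.2] with x hx h1 h2 hxX
    exact congrArg F (hx.1.2 x _ ⟨⟨hxX, rfl⟩, h1, h2⟩ (hτX _ hx.1))
  · exact congrArg F (huniq p _ ⟨⟨hpX, rfl⟩, hpb⟩ (hτX _ hu.self_of_nhds.1))

/-- Extending `f` to a total definable map brings it within reach of the calculus of `DefMap`;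
continuity of `f` becomes continuity of the extension within `X`. -/
theorem IsDefMap.exists_defMap {m n : ℕ} {X : Set (Fin m → M)} {f : X → (Fin n → M)}
    (hf : IsDefMap L f) : ∃ F : (Fin m → M) → (Fin n → M), DefMap L M F ∧ ∀ x : X, F x = f x := by
  have happ : DefMap L M (fun p : (Fin m → M) × (Fin n → M) => Fin.append p.1 p.2) := by
    refine DefMap.pi (f := fun i (p : (Fin m → M) × (Fin n → M)) => Fin.append p.1 p.2 i) fun i => ?_
    refine Fin.addCases (fun i => ?_) (fun i => ?_) i
    · simpa using DefMap.id.fst.apply i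
    · simpa using DefMap.id.snd.apply i
  have hG : ∀ (x : X) y, Fin.append (x : Fin m → M) y ∈ graphSet f ↔ y = f x := by
    intro x y
    constructor
    · rintro ⟨x', hx'⟩
      have := (Fin.appendEquiv m n).injective (a₁ := ((x : Fin m → M), y)) (a₂ := (↑x', f x')) hx'
      obtain ⟨h1, h2⟩ := Prod.ext_iff.1 this
      rw [Subtype.ext h1]
      exact h2
    · rintro rfl
      exact ⟨x, rfl⟩
  obtain ⟨F, hF, hFX⟩ := TameDim.exists_defMap
    (R := fun (x : Fin m → M) (y : Fin n → M) => Fin.append x y ∈ graphSet f)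
    (IsDef.defPred hf.1) ((IsDef.defPred hf.2).mem happ)
    (fun x hx => ⟨f ⟨x, hx⟩, (hG ⟨x, hx⟩ _).2 rfl, fun y hy => (hG ⟨x, hx⟩ _).1 hy⟩)
  exact ⟨F, hF, fun x => (hG x _).1 (hFX x x.2)⟩

theorem dim_range_le {m n : ℕ} {X : Set (Fin m → M)} {f : X → (Fin n → M)}
    (hf : IsDefMap L f) : dim (range f) ≤ dim X := by
  obtain ⟨F, hF, hFX⟩ := hf.exists_defMap
  refine (dim_mono ?_).trans (dim_image_le hf.1 hF)
  rintro _ ⟨x, rfl⟩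
  exact ⟨x, x.2, hFX x⟩

theorem dim_discontSet_lt {m n : ℕ} {X : Set (Fin m → M)} {f : X → (Fin n → M)}
    (hf : IsDefMap L f) (hne : X.Nonempty) : dim (discontSet f) < dim X := by
  obtain ⟨F, hF, hFX⟩ := hf.exists_defMap
  refine (dim_mono ?_).trans_lt (dim_not_continuousWithinAt_lt hf.1 hne hF)
  rintro _ ⟨x, hx, rfl⟩
  refine ⟨x.2, fun h => hx ?_⟩
  have := continuousWithinAt_iff_continuousAt_domRestrict F x.2 |>.1 h
  convert this using 1
  exact (funext hFX).symm

end

end TameDim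

theorem mainTheorem1 (L : FirstOrder.Language.{u, v}) [L.IsOrdered] (M : Type w)
    [LinearOrder M] [DenselyOrdered M] [NoMinOrder M] [NoMaxOrder M] [Nonempty M]
    [TopologicalSpace M] [OrderTopology M] [L.Structure M] [L.OrderedStructure M]
    (hcomplete : TameDim.DefinablyComplete L M) (hlocal : TameDim.LocallyOMinimal L M)
    (ha : TameDim.PropertyA L M) :
    (∀ (n : ℕ) (X Y : Set (Fin n → M)), TameDim.IsDef L X → TameDim.IsDef L Y → X ⊆ Y →
      TameDim.dim X ≤ TameDim.dim Y) ∧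
    (∀ (n : ℕ) (σ : Equiv.Perm (Fin n)) (X : Set (Fin n → M)), TameDim.IsDef L X →
      TameDim.dim X = TameDim.dim ((fun (x : Fin n → M) (i : Fin n) => x (σ i)) '' X)) ∧
    (∀ (m n : ℕ) (X : Set (Fin m → M)) (Y : Set (Fin n → M)),
      TameDim.IsDef L X → TameDim.IsDef L Y →
      TameDim.dim (TameDim.prodSet X Y) = TameDim.dim X + TameDim.dim Y) ∧
    (∀ (n : ℕ) (X Y : Set (Fin n → M)), TameDim.IsDef L X → TameDim.IsDef L Y →
      TameDim.dim (X ∪ Y) = max (TameDim.dim X) (TameDim.dim Y)) ∧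
    (∀ (m n : ℕ) (X : Set (Fin m → M)) (f : X → (Fin n → M)), TameDim.IsDefMap L f →
      TameDim.dim (Set.range f) ≤ TameDim.dim X) ∧
    (∀ (m n : ℕ) (X : Set (Fin m → M)) (f : X → (Fin n → M)), TameDim.IsDefMap L f →
      X.Nonempty → TameDim.dim (TameDim.discontSet f) < TameDim.dim X) ∧
    (∀ (n : ℕ) (X : Set (Fin n → M)), TameDim.IsDef L X → X.Nonempty →
      TameDim.dim (closure X \ X) < TameDim.dim X) := by
  have : TameDim.Tame L M := ⟨hcomplete, hlocal, ha⟩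
  refine ⟨fun n X Y _ _ h => TameDim.dim_mono h, fun n σ X _ => TameDim.dim_perm σ X,
    fun m n X Y _ _ => le_antisymm (TameDim.dim_prodSet_le X Y) (TameDim.le_dim_prodSet X Y),
    fun n X Y hX hY => TameDim.dim_union hX hY, fun m n X f hf => TameDim.dim_range_le hf,
    fun m n X f hf hne => TameDim.dim_discontSet_lt hf hne,
    fun n X hX hne => TameDim.dim_closure_diff_lt hX hne⟩
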